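/- Let $k\ge 1$. For a Banach space $\mathbb E$ (real), a \emph{finitely supported array} is a family $f=(f_{i_1,\dots,i_k})_{i_1,\dots,i_k\in\mathbb N}$ of vectors of $\mathbb E$ with only finitely many non-zero entries. It is \emph{diagonal-free} if $f_{i_1,\dots,i_k}=0$ whenever two of the indices coincide, \emph{symmetric} if $f_{i_{\sigma(1)},\dots,i_{\sigma(k)}}=f_{i_1,\dots,i_k}$ for every permutation $\sigma$ of $\{1,\dots,k\}$, and \emph{tetrahedral} if $f_{i_1,\dots,i_k}=0$ unless $i_1<\dots<i_k$. For a real sequence $x=(x_i)$ put $$Q(f,x^k)=\sum_{i_1,\dots,i_k} f_{i_1,\dots,i_k}\,x_{i_1}\cdots x_{i_k},\qquad T_{m_1,\dots,m_k}Q(f,x^k)=\sum_{i_1\le m_1,\dots,i_k\le m_k} f_{i_1,\dots,i_k}\,x_{i_1}\cdots x_{i_k}.$$ There are constants $c,C>0$, depending only on $k$, such that for every real Banach space $\mathbb E$, every finitely supported diagonal-free array $f$ in $\mathbb E$, and every sequence $\xi=(\xi_i)$ of independent symmetric real random variables (not necessarily identically distributed) on a probability space: (i) (Contraction inequality) for every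 real sequence $s=(s_i)$ with $\sup_i|s_i|\le 1$ and every $t>0$, with $s\xi=(s_i\xi_i)$, $$P\big(\|Q(f,(s\xi)^k)\|>ct\big)\le c\,P\big(\|Q(f,\xi^k)\|>t\big);$$ (ii) (Maximal inequality) if moreover $f$ is symmetric or tetrahedral, then for every $t>0$, $$P\Big(\sup_{m_1,\dots,m_k}\|T_{m_1,\dots,m_k}Q(f,\xi^k)\|>Ct\Big)\le C\,P\big(\|Q(f,\xi^k)\|>t\big).$$ -/

import Mathlib

open MeasureTheory ProbabilityTheory

universe u v

namespace RandomPoly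

/-- An array `(f_{i₁,…,i_k})` of vectors of `E`, only finitely many of which are non-zero. -/
abbrev FinArray (k : ℕ) (E : Type*) [Zero E] := (Fin k → ℕ) →₀ E

section Arrays

variable {k : ℕ} {E : Type*} [Zero E]

/-- `f` vanishes as soon as two of the indices `i₁,…,i_k` coincide. -/
def DiagonalFree (f : FinArray k E) : Prop :=
  ∀ i : Fin k → ℕ, (∃ a b : Fin k, a ≠ b ∧ i a = i b) → f i = 0

/-- `f` is invariant under all permutations of its `k` indices. -/
def SymmetricArray (f : FinArray k E) : Prop :=
  ∀ (σ : Equiv.Perm (Fin k)) (i : Fin k → ℕ), f (fun j => i (σ j)) = f i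

/-- `f` vanishes unless `i₁ < ⋯ < i_k`. -/
def Tetrahedral (f : FinArray k E) : Prop :=
  ∀ i : Fin k → ℕ, ¬ StrictMono i → f i = 0

end Arrays

section Polynomials

variable {k : ℕ} {E : Type*} [NormedAddCommGroup E] [NormedSpace ℝ E]

/-- The `k`-linear form `Q(f; x₁,…,x_k) = ∑ f_{i₁,…,i_k} x_{1 i₁} ⋯ x_{k i_k}`. -/
noncomputable def Q (f : FinArray k E) (x : Fin k → ℕ → ℝ) : E :=
  ∑ i ∈ f.support, (∏ j, x j (i j)) • f i

/-- The partial sum `T_{m₁,…,m_k} Q(f; x₁,…,x_k)`, over `i₁ ≤ m₁, …, i_k ≤ m_k`. -/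
noncomputable def T (m : Fin k → ℕ) (f : FinArray k E) (x : Fin k → ℕ → ℝ) : E :=
  ∑ i ∈ f.support with ∀ j, i j ≤ m j, (∏ j, x j (i j)) • f i

/-- The supremum of `‖T_{m₁,…,m_k} Q(f; x₁,…,x_k)‖` over all `m₁,…,m_k`. -/
noncomputable def maxT (f : FinArray k E) (x : Fin k → ℕ → ℝ) : ℝ :=
  ⨆ m : Fin k → ℕ, ‖T m f x‖

/-- The supremum defining `maxT` is always a genuine (finite) supremum. -/
theorem bddAbove_T (f : FinArray k E) (x : Fin k → ℕ → ℝ) :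
    BddAbove (Set.range fun m : Fin k → ℕ => ‖T m f x‖) := by
  refine ⟨∑ i ∈ f.support, ‖(∏ j, x j (i j)) • f i‖, ?_⟩
  rintro _ ⟨m, rfl⟩
  exact (norm_sum_le _ _).trans
    (Finset.sum_le_sum_of_subset_of_nonneg (Finset.filter_subset _ _)
      fun _ _ _ => norm_nonneg _)

end Polynomials

/-- `ξ` is a sequence of independent symmetric real random variables. -/
structure IsSymmIndep {Ω : Type*} [MeasurableSpace Ω] (μ : Measure Ω) (ξ : ℕ → Ω → ℝ) :
    Prop where
  measurable : ∀ i, Measurable (ξ i)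
  indep : iIndepFun ξ μ
  symm : ∀ i, IdentDistrib (fun ω => -ξ i ω) (ξ i) μ μ

end RandomPoly

/-!
Let `k` be the degree. Changing the signs of independent symmetric variables by fixed numbers `±1`
does not change their joint law, so both inequalities may be proved for `∑ f_i ε_{i₁} x_{i₁} ⋯`,
with fixed real numbers `x_n` and a uniformly distributed vector of signs `ε`
(`IsSymmIndep.measureReal_le`). As the `x_n` can be absorbed into the array, only statements about
counting sign vectors remain.

The source of all lower bounds for probabilities is hypercontractivity: a function `Y` of degree at
most `k` on a finite product space satisfies `E Y⁴ ≤ D (E Y²)²`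
(`expect_pow_four_le_of_dependsOn`), so by Paley–Zygmund `|Y| ≥ |E Y| / 2` with probability bounded
below. Through a norming functional this passes to vector-valued forms without diagonal in
independent variables (`halfProb_le_pr`). It is used for variables `δ_i` that are uniformly
distributed on the `k` arguments of the form, and gives decoupling in both directions:

* the form in `ε` is, up to the factor `k ^ k`, the mean over `δ` of the form in the vectors
  `(1_{δ_i = j} ε_i)_i`, which are distributed like truncations of independent sign vectors `e_j`
  (`pr_form_le_decoupled`);
* by polarization, the decoupled form of a symmetric array is controlled by the form in `∑ e_j`,
  which is up to the factor `k ^ k` the mean over `δ` of the form in the sign vector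
  `(e_{δ_i, i})_i` (`pr_decoupled_le_form`).

For the decoupled form, Lévy's inequality can be applied to one argument at a time
(`levy_decoupled`), and the maximal inequality for symmetric arrays follows (`pr_max_cut_le`), for
truncations to the sets of an arbitrary chain of sets of indices. A truncation of a tetrahedral form
is a combination, with coefficients depending on `k` only, of truncations of its symmetrization:
whether the sorted indices stay below given thresholds is determined by the truth values of
`i_a ≤ m_j`, hence is a polynomial in their indicators (`norm_form_cut_le_of_tetrahedral`). The
contraction inequality is another consequence of the maximal inequality for chains, since the form
at `s ε` with `0 ≤ s ≤ 1` is an average of truncations to superlevel sets of `s`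
(`norm_form_mul_le`).
-/

open scoped BigOperators

namespace RandomPoly

/-! ### Hypercontractivity for functions of low degree on a finite product space -/

section LowDegree

variable {ι Ω : Type*} [DecidableEq ι]

/-- `LowDeg d Y` says that `Y`, as a function of the independent coordinates `δ i ∈ Ω`, has degree
at most `d`: all its `(d + 1)`-fold differences, each taken in a single coordinate, vanish. -/
def LowDeg : ℕ → ((ι → Ω) → ℝ) → Prop
  | 0, Y => ∀ (i : ι) (a b : Ω) (δ : ι → Ω),
      Y (Function.update δ i a) - Y (Function.update δ i b) = 0
  | d + 1, Y => ∀ (i : ι) (a b : Ω),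
      LowDeg d fun δ => Y (Function.update δ i a) - Y (Function.update δ i b)

theorem LowDeg.zero (d : ℕ) : LowDeg d (fun _ : ι → Ω => (0 : ℝ)) := by
  induction d with
  | zero => intro i a b δ; simp
  | succ d ih => intro i a b; simpa using ih

theorem LowDeg.add {d : ℕ} {Y Z : (ι → Ω) → ℝ} (hY : LowDeg d Y) (hZ : LowDeg d Z) :
    LowDeg d fun δ => Y δ + Z δ := by
  induction d generalizing Y Z with
  | zero =>
    intro i a b δ
    linear_combination hY i a b δ + hZ i a b δ
  | succ d ih =>
    intro i a b
    convert ih (hY i a b) (hZ i a b) using 2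
    ring

theorem LowDeg.const_mul {d : ℕ} {Y : (ι → Ω) → ℝ} (c : ℝ) (hY : LowDeg d Y) :
    LowDeg d fun δ => c * Y δ := by
  induction d generalizing Y with
  | zero =>
    intro i a b δ
    linear_combination c * hY i a b δ
  | succ d ih =>
    intro i a b
    convert ih (hY i a b) using 2
    ring

theorem LowDeg.sum {d : ℕ} {α : Type*} (s : Finset α) {Y : α → (ι → Ω) → ℝ}
    (h : ∀ a ∈ s, LowDeg d (Y a)) : LowDeg d fun δ => ∑ a ∈ s, Y a δ := by
  classical
  induction s using Finset.induction_on with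
  | empty => simpa using LowDeg.zero d
  | insert a s ha ih =>
    simp only [Finset.sum_insert ha]
    exact (h a (by simp)).add (ih fun b hb => h b (by simp [hb]))

theorem LowDeg.expect {d : ℕ} {α : Type*} [Fintype α] {Y : α → (ι → Ω) → ℝ}
    (h : ∀ a, LowDeg d (Y a)) : LowDeg d fun δ => 𝔼 a, Y a δ := by
  simp only [Fintype.expect_eq_sum_div_card, div_eq_inv_mul]
  exact (LowDeg.sum _ fun a _ => h a).const_mul _

theorem LowDeg.comp_update {d : ℕ} {Y : (ι → Ω) → ℝ} (hY : LowDeg d Y) (n : ι) (c : Ω) :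
    LowDeg d fun δ => Y (Function.update δ n c) := by
  induction d generalizing Y with
  | zero =>
    intro i a b δ
    by_cases hin : i = n
    · subst hin; simp
    · simp only [Function.update_comm hin]
      exact hY i a b _
  | succ d ih =>
    intro i a b
    by_cases hin : i = n
    · subst hin; simpa using LowDeg.zero d
    · simpa only [Function.update_comm hin] using ih (hY i a b)

/-- A function of `d` coordinates has degree at most `d`. -/
theorem lowDeg_of_dependsOn {d : ℕ} {Y : (ι → Ω) → ℝ} {S : Finset ι} (hS : S.card ≤ d)
    (hY : DependsOn Y (S : Set ι)) : LowDeg d Y := by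
  have out : ∀ {S : Finset ι} {Y : (ι → Ω) → ℝ}, DependsOn Y (S : Set ι) →
      ∀ i ∉ S, ∀ a b δ, Y (Function.update δ i a) = Y (Function.update δ i b) := by
    intro S Y hY i hi a b δ
    refine hY fun j hj => ?_
    have : j ≠ i := fun h => hi (h ▸ Finset.mem_coe.1 hj)
    simp [Function.update_of_ne this]
  induction d generalizing S Y with
  | zero =>
    intro i a b δ
    rw [out hY i (by simp_all) a b δ, sub_self]
  | succ d ih =>
    intro i a b
    by_cases hi : i ∈ S
    · refine ih (S := S.erase i) (by rw [Finset.card_erase_of_mem hi]; omega) ?_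
      intro δ δ' h
      have : ∀ c, Y (Function.update δ i c) = Y (Function.update δ' i c) := by
        intro c
        refine hY fun j hj => ?_
        by_cases hji : j = i
        · subst hji; simp
        · simp only [Function.update_of_ne hji]
          exact h j (by simpa [hji] using hj)
      simp only [this]
    · simp only [out hY i hi a b, sub_self]
      exact LowDeg.zero d

/-- Redrawing one coordinate does not change an expectation. -/
theorem expect_update [Fintype ι] [Fintype Ω] [Nonempty Ω] (n : ι) (g : (ι → Ω) → ℝ) :
    𝔼 δ, g δ = 𝔼 δ : ι → Ω, 𝔼 a, g (Function.update δ n a) := by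
  -- Exchanging `δ n` and `a` is a bijection of the pairs `(δ, a)`.
  let e : (ι → Ω) × Ω ≃ (ι → Ω) × Ω :=
    { toFun := fun p => (Function.update p.1 n p.2, p.1 n)
      invFun := fun p => (Function.update p.1 n p.2, p.1 n)
      left_inv := fun p => by simp
      right_inv := fun p => by simp }
  have h1 : 𝔼 p : (ι → Ω) × Ω, g p.1 = 𝔼 δ, g δ := by
    rw [← Finset.univ_product_univ, Finset.expect_product]
    simp
  have h2 : 𝔼 p : (ι → Ω) × Ω, g (Function.update p.1 n p.2) =
      𝔼 δ : ι → Ω, 𝔼 a, g (Function.update δ n a) := by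
    rw [← Finset.univ_product_univ, Finset.expect_product]
  rw [← h1, ← h2]
  exact (Fintype.expect_equiv e _ _ fun p => rfl).symm

/-- The term `4 A ^ 3 B` averages to zero, and `4 A B ^ 3 ≤ 2 A ^ 2 B ^ 2 + 2 B ^ 4`. -/
theorem expect_add_pow_four_le [Fintype Ω] [Nonempty Ω] (A : ℝ) (B : Ω → ℝ)
    (hB : 𝔼 a, B a = 0) :
    𝔼 a, (A + B a) ^ 4 ≤ A ^ 4 + 8 * 𝔼 a, (A ^ 2 * B a ^ 2) + 3 * 𝔼 a, B a ^ 4 := by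
  have h1 : ∀ a, (A + B a) ^ 4 ≤
      A ^ 4 + 4 * A ^ 3 * B a + 8 * (A ^ 2 * B a ^ 2) + 3 * B a ^ 4 := by
    intro a
    nlinarith [mul_nonneg (sq_nonneg (B a)) (sq_nonneg (A - B a))]
  refine (Finset.expect_le_expect fun a _ => h1 a).trans (le_of_eq ?_)
  simp only [Finset.expect_add_distrib, ← Finset.mul_expect, hB, Fintype.expect_const]
  ring

theorem expect_add_sq [Fintype Ω] [Nonempty Ω] (A : ℝ) (B : Ω → ℝ) (hB : 𝔼 a, B a = 0) :
    𝔼 a, (A + B a) ^ 2 = A ^ 2 + 𝔼 a, B a ^ 2 := by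
  have h1 : ∀ a, (A + B a) ^ 2 = A ^ 2 + 2 * A * B a + B a ^ 2 := fun a => by ring
  simp only [h1, Finset.expect_add_distrib, ← Finset.mul_expect, hB, Fintype.expect_const]
  ring

theorem expect_sq_le_card_mul [Fintype Ω] (b : Ω → ℝ) (hb : ∀ a, 0 ≤ b a) :
    𝔼 a, b a ^ 2 ≤ (Fintype.card Ω : ℝ) * (𝔼 a, b a) ^ 2 := by
  rcases isEmpty_or_nonempty Ω with h | h
  · simp
  have hK : (0 : ℝ) < Fintype.card Ω := by exact_mod_cast Fintype.card_pos
  simp only [Fintype.expect_eq_sum_div_card]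
  rw [div_pow, mul_div_assoc', div_le_div_iff₀ hK (by positivity)]
  have := Finset.sum_sq_le_sq_sum_of_nonneg (s := Finset.univ) (f := b) fun a _ => hb a
  nlinarith [mul_le_mul_of_nonneg_left this (sq_nonneg (Fintype.card Ω : ℝ))]

/-- The arithmetic of the induction step in Bonami's inequality: `x`, `y`, `w` are the fourth
moments of `A + B`, `A`, `B`, while `z` is the mean of `A ^ 2 B ^ 2`, and `α`, `b` are the second
moments of `A` and `B`. -/
theorem le_mul_add_sq_of_moment_bounds {x y z w r K α b : ℝ} (hK : 1 ≤ K) (hr : 0 ≤ r)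
    (hα : 0 ≤ α) (hb : 0 ≤ b)
    (h : x ≤ y + 8 * z + 3 * w) (hy : y ≤ r * (4 * K) ^ 2 * α ^ 2)
    (hz : z ≤ r * (4 * K) * α * b) (hw : w ≤ r * (K * b ^ 2)) :
    x ≤ r * (4 * K) ^ 2 * (α + b) ^ 2 := by
  have hK' : 0 ≤ K - 1 := by linarith
  have f1 : 0 ≤ 32 * (r * K * (K - 1) * (α * b)) := by positivity
  have f2 : 0 ≤ 3 * (r * K * (K - 1) * b ^ 2) := by positivity
  have f3 : 0 ≤ 13 * (r * K ^ 2 * b ^ 2) := by positivity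
  have key : r * (4 * K) ^ 2 * (α + b) ^ 2 = r * (4 * K) ^ 2 * α ^ 2 +
      8 * (r * (4 * K) * α * b) + 3 * (r * (K * b ^ 2)) + 32 * (r * K * (K - 1) * (α * b)) +
      3 * (r * K * (K - 1) * b ^ 2) + 13 * (r * K ^ 2 * b ^ 2) := by ring
  linarith

/-- Bonami's inequality between the fourth and the second moment of a function of degree at most
`d`, by induction on the set of coordinates it depends on: one splits off a coordinate `n` by
`Y = A + B`, where `A` is the average of `Y` over the coordinate `n`, so that `B` has degree less
than `d` once that coordinate is frozen. -/
theorem expect_pow_four_le_of_dependsOn [Fintype ι] [Fintype Ω] [Nonempty Ω] (I : Finset ι)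
    {d : ℕ} {Y : (ι → Ω) → ℝ} (hI : DependsOn Y (I : Set ι)) (hY : LowDeg d Y) :
    𝔼 δ, Y δ ^ 4 ≤ (4 * Fintype.card Ω : ℝ) ^ (2 * d) * (𝔼 δ, Y δ ^ 2) ^ 2 := by
  have hK : (1 : ℝ) ≤ Fintype.card Ω := by exact_mod_cast Fintype.card_pos
  set K : ℝ := (Fintype.card Ω : ℝ)
  have hR : (1 : ℝ) ≤ 4 * K := by linarith
  have const_case : ∀ (d : ℕ) (Y : (ι → Ω) → ℝ), (∀ δ δ', Y δ = Y δ') →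
      𝔼 δ, Y δ ^ 4 ≤ (4 * K) ^ (2 * d) * (𝔼 δ, Y δ ^ 2) ^ 2 := by
    intro d Y h
    have δ₀ : ι → Ω := fun _ => Classical.arbitrary Ω
    simp only [fun δ => h δ δ₀, Fintype.expect_const]
    have : 1 ≤ (4 * K) ^ (2 * d) := one_le_pow₀ hR
    nlinarith [sq_nonneg (Y δ₀ ^ 2)]
  induction I using Finset.induction_on generalizing d Y with
  | empty =>
    exact const_case d Y fun δ δ' => hI (by simp)
  | insert n I hn ih =>
    have hdep : ∀ c, DependsOn (fun δ => Y (Function.update δ n c)) (I : Set ι) := by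
      intro c δ δ' h
      refine hI fun j hj => ?_
      by_cases hjn : j = n
      · subst hjn; simp
      · simp only [Function.update_of_ne hjn]
        exact h j (by simpa [hjn] using hj)
    set A : (ι → Ω) → ℝ := fun δ => 𝔼 c, Y (Function.update δ n c) with hA
    set B : Ω → (ι → Ω) → ℝ := fun a δ => Y (Function.update δ n a) - A δ with hB
    have hAdep : DependsOn A (I : Set ι) := by
      intro δ δ' h
      exact Finset.expect_congr rfl fun c _ => hdep c h
    have hBdep : ∀ a, DependsOn (B a) (I : Set ι) := by
      intro a δ δ' h
      simp only [hB, hAdep h, hdep a h]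
    have hAdeg : LowDeg d A := LowDeg.expect fun c => hY.comp_update n c
    have hB0 : ∀ δ, 𝔼 a, B a δ = 0 := by
      intro δ
      simp only [hB, Finset.expect_sub_distrib, Fintype.expect_const, hA, sub_self]
    have hYAB : ∀ δ a, Y (Function.update δ n a) = A δ + B a δ := fun δ a => by simp [hB]
    have hBeq : ∀ a, B a = fun δ =>
        𝔼 c, (Y (Function.update δ n a) - Y (Function.update δ n c)) := by
      intro a; funext δ
      simp only [hB, hA, Finset.expect_sub_distrib, Fintype.expect_const]
    set α := 𝔼 δ, A δ ^ 2
    set β : Ω → ℝ := fun a => 𝔼 δ, B a δ ^ 2 with hβ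
    have hα0 : 0 ≤ α := Finset.expect_nonneg fun _ _ => sq_nonneg _
    have hβ0 : ∀ a, 0 ≤ β a := fun a => Finset.expect_nonneg fun _ _ => sq_nonneg _
    have h2 : 𝔼 δ, Y δ ^ 2 = α + 𝔼 a, β a := by
      rw [expect_update n]
      simp only [hYAB, expect_add_sq _ _ (hB0 _), Finset.expect_add_distrib]
      rw [Finset.expect_comm]
    have h4 : 𝔼 δ, Y δ ^ 4 ≤ 𝔼 δ, A δ ^ 4 + 8 * 𝔼 a, 𝔼 δ, (A δ ^ 2 * B a δ ^ 2) +
        3 * 𝔼 a, 𝔼 δ, B a δ ^ 4 := by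
      rw [expect_update n]
      simp only [hYAB]
      refine (Finset.expect_le_expect fun δ _ => expect_add_pow_four_le _ _ (hB0 δ)).trans
        (le_of_eq ?_)
      simp only [Finset.expect_add_distrib, ← Finset.mul_expect]
      congr 2
      · rw [Finset.expect_comm]
        simp only [Finset.mul_expect]
      · rw [Finset.expect_comm]
    have hA4 := ih hAdep hAdeg
    rw [h2]
    cases d with
    | zero =>
      have hBz : ∀ a δ, B a δ = 0 := by
        intro a δ
        rw [hBeq]
        exact Finset.expect_eq_zero fun c _ => hY n a c δ
      simp only [hBz, hβ] at h4 ⊢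
      simpa using h4.trans (by simpa using hA4)
    | succ d =>
      have hBdeg : ∀ a, LowDeg d (B a) := by
        intro a
        rw [hBeq]
        exact LowDeg.expect fun c => hY n a c
      have hB4 : ∀ a, 𝔼 δ, B a δ ^ 4 ≤ (4 * K) ^ (2 * d) * β a ^ 2 := fun a =>
        ih (hBdep a) (hBdeg a)
      set r := (4 * K) ^ (2 * d) with hr
      have hr0 : 0 ≤ r := by positivity
      have hr2 : (4 * K) ^ (2 * (d + 1)) = r * (4 * K) ^ 2 := by rw [hr, ← pow_add]; ring_nf
      rw [hr2] at hA4 ⊢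
      have hAB : ∀ a, 𝔼 δ, (A δ ^ 2 * B a δ ^ 2) ≤ r * (4 * K) * α * β a := by
        intro a
        have hcs := Finset.expect_mul_sq_le_sq_mul_sq Finset.univ
          (fun δ => A δ ^ 2) (fun δ => B a δ ^ 2)
        simp only [← pow_mul] at hcs
        norm_num at hcs
        refine abs_le_of_sq_le_sq' ?_ (by have := hβ0 a; positivity) |>.2
        refine hcs.trans ?_
        calc _ ≤ (r * (4 * K) ^ 2 * α ^ 2) * (r * β a ^ 2) :=
              mul_le_mul hA4 (hB4 a) (Finset.expect_nonneg fun _ _ => by positivity) (by positivity)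
          _ = _ := by ring
      have e1 : 𝔼 a, 𝔼 δ, (A δ ^ 2 * B a δ ^ 2) ≤ r * (4 * K) * α * 𝔼 a, β a := by
        rw [Finset.mul_expect]
        exact Finset.expect_le_expect fun a _ => hAB a
      have e2 : 𝔼 a, 𝔼 δ, B a δ ^ 4 ≤ r * (K * (𝔼 a, β a) ^ 2) := by
        refine (Finset.expect_le_expect fun a _ => hB4 a).trans ?_
        rw [← Finset.mul_expect]
        exact mul_le_mul_of_nonneg_left (expect_sq_le_card_mul β hβ0) hr0
      have hb : 0 ≤ 𝔼 a, β a := Finset.expect_nonneg fun a _ => hβ0 a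
      set b := 𝔼 a, β a
      exact le_mul_add_sq_of_moment_bounds hK hr0 hα0 hb h4 hA4 e1 e2

end LowDegree

/-! ### Counting probabilities -/

open Classical in
/-- The probability of `P` under the uniform distribution on a finite type. -/
noncomputable def pr {α : Type*} [Fintype α] (P : α → Prop) : ℝ := 𝔼 a, if P a then 1 else 0

section Pr

variable {α β : Type*} [Fintype α] [Fintype β]

theorem pr_nonneg (P : α → Prop) : 0 ≤ pr P :=
  Finset.expect_nonneg fun a _ => by split_ifs <;> norm_num

theorem pr_mono {P R : α → Prop} (h : ∀ a, P a → R a) : pr P ≤ pr R := by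
  refine Finset.expect_le_expect fun a _ => ?_
  by_cases hP : P a
  · simp [hP, h a hP]
  · rw [if_neg hP]; split_ifs <;> norm_num

theorem pr_equiv (e : α ≃ β) (P : β → Prop) : pr (fun a => P (e a)) = pr P :=
  Fintype.expect_equiv e _ _ fun _ => rfl

theorem pr_or_le (P R : α → Prop) : pr (fun a => P a ∨ R a) ≤ pr P + pr R := by
  unfold pr
  rw [← Finset.expect_add_distrib]
  refine Finset.expect_le_expect fun a _ => ?_
  by_cases hP : P a <;> by_cases hR : R a <;> simp [hP, hR]

theorem pr_exists_le {γ : Type*} [Fintype γ] (P : γ → α → Prop) :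
    pr (fun a => ∃ c, P c a) ≤ ∑ c, pr (P c) := by
  classical
  unfold pr
  rw [← Finset.expect_sum_comm]
  refine Finset.expect_le_expect fun a _ => ?_
  by_cases h : ∃ c, P c a
  · obtain ⟨c, hc⟩ := h
    rw [if_pos ⟨c, hc⟩]
    refine le_trans (by simp [hc]) (Finset.single_le_sum
      (f := fun c => if P c a then (1 : ℝ) else 0) (fun i _ => ?_) (Finset.mem_univ c))
    split_ifs <;> norm_num
  · rw [if_neg h]
    exact Finset.sum_nonneg fun i _ => by split_ifs <;> norm_num

theorem expect_pr_comm (P : α → β → Prop) : 𝔼 a, pr (P a) = 𝔼 b, pr fun a => P a b :=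
  Finset.expect_comm _ _ _

/-- If `P` forces `R` with conditional probability at least `c`, then `R` has probability at least
`c` times that of `P`. -/
theorem mul_pr_le_expect_pr {c : ℝ} {P : α → Prop} {R : α → β → Prop}
    (h : ∀ a, P a → c ≤ pr (R a)) : c * pr P ≤ 𝔼 a, pr (R a) := by
  unfold pr
  rw [Finset.mul_expect]
  refine Finset.expect_le_expect fun a _ => ?_
  by_cases hP : P a
  · simpa [hP, pr] using h a hP
  · simpa [hP, pr] using pr_nonneg (R a)

/-- The image of the uniform distribution under a map `φ` that is equivariant for the translations
of a finite group `H` is uniform. -/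
theorem pr_comp_equivariant {H : Type*} [Group H] [Fintype H] [Nonempty α] (φ : α → H)
    (ψ : H → α ≃ α) (hψ : ∀ h a, φ (ψ h a) = h * φ a) (P : H → Prop) :
    pr (fun a => P (φ a)) = pr P := by
  have h1 : 𝔼 _h : H, pr (fun a => P (φ a)) = 𝔼 h : H, pr (fun a => P (h * φ a)) := by
    refine Finset.expect_congr rfl fun h _ => ?_
    rw [← pr_equiv (ψ h)]
    simp only [hψ]
  have h2 : ∀ a, pr (fun h : H => P (h * φ a)) = pr P := fun a =>
    pr_equiv (Equiv.mulRight (φ a)) P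
  rw [Fintype.expect_const] at h1
  rw [h1, expect_pr_comm]
  simp only [h2, Fintype.expect_const]

/-- The Paley–Zygmund inequality, in terms of a bound on the fourth moment. -/
theorem pr_half_le_abs_ge [Nonempty α] (Y : α → ℝ) {D : ℝ} (hD : 1 ≤ D)
    (h4 : 𝔼 a, Y a ^ 4 ≤ D * (𝔼 a, Y a ^ 2) ^ 2) :
    1 / (2 * D) ≤ pr fun a => |𝔼 b, Y b| / 2 ≤ |Y a| := by
  classical
  set m := 𝔼 b, Y b with hm
  set p := pr fun a => |m| / 2 ≤ |Y a| with hp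
  set v := 𝔼 a, Y a ^ 2 with hv
  have hmv : m ^ 2 ≤ v := by
    have := Finset.expect_mul_sq_le_sq_mul_sq Finset.univ Y (fun _ => (1 : ℝ))
    simpa using this
  have hp0 : 0 ≤ p := pr_nonneg _
  have hD1 : v = 0 ∨ 0 < v :=
    (Finset.expect_nonneg fun _ _ => sq_nonneg _ : 0 ≤ v).eq_or_lt.imp Eq.symm id
  -- Where `|Y| < |m| / 2` one has `Y ^ 2 ≤ m ^ 2 / 4`, and `m ^ 2 ≤ v`.
  have hsplit : v ≤ 𝔼 a, (Y a ^ 2 * if |m| / 2 ≤ |Y a| then 1 else 0) + m ^ 2 / 4 := by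
    rw [hv, ← Fintype.expect_const (ι := α) (m ^ 2 / 4), ← Finset.expect_add_distrib]
    refine Finset.expect_le_expect fun a _ => ?_
    split_ifs with h
    · nlinarith [sq_nonneg m]
    · push Not at h
      have := mul_self_lt_mul_self (abs_nonneg _) h
      nlinarith [abs_mul_abs_self (Y a), abs_mul_abs_self m]
  have hcs : (𝔼 a, (Y a ^ 2 * if |m| / 2 ≤ |Y a| then 1 else 0)) ^ 2 ≤ D * v ^ 2 * p := by
    refine (Finset.expect_mul_sq_le_sq_mul_sq _ _ _).trans ?_
    have e1 : 𝔼 a, (if |m| / 2 ≤ |Y a| then (1 : ℝ) else 0) ^ 2 = p := by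
      simp only [hp, pr]
      refine Finset.expect_congr rfl fun a _ => ?_
      split_ifs <;> norm_num
    rw [e1]
    refine mul_le_mul_of_nonneg_right ?_ hp0
    simpa only [← pow_mul] using h4
  rcases hD1 with h0 | h0
  · have hm0 : m = 0 := by nlinarith
    have hp1 : p = 1 := by simp [hp, pr, hm0]
    rw [hp1, div_le_iff₀ (by positivity)]
    linarith
  · set w := 𝔼 a, (Y a ^ 2 * if |m| / 2 ≤ |Y a| then 1 else 0)
    have hw : 3 / 4 * v ≤ w := by linarith
    have : (3 / 4 * v) ^ 2 ≤ D * v ^ 2 * p := (pow_le_pow_left₀ (by positivity) hw 2).trans hcs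
    have h9 : 9 / 16 ≤ D * p := by
      by_contra hlt
      push Not at hlt
      nlinarith [sq_pos_of_pos h0]
    rw [div_le_iff₀ (by positivity)]
    linarith

end Pr

/-! ### Multilinear forms of finite arrays -/

section Product

variable {κ ι : Type*} [Fintype κ] [Fintype ι] [DecidableEq ι]

theorem expect_prod {Ω : Type*} [Fintype Ω] [Nonempty Ω] (h : ι → Ω → ℝ) :
    𝔼 δ : ι → Ω, ∏ n, h n (δ n) = ∏ n, 𝔼 a, h n a := by
  simp only [Fintype.expect_eq_sum_div_card, Finset.prod_div_distrib, Fintype.card_fun,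
    Finset.prod_const, Finset.card_univ, Nat.cast_pow]
  rw [← Fintype.piFinset_univ, Finset.sum_prod_piFinset]

theorem expect_prod_comp_injective {Ω : Type*} [Fintype Ω] [Nonempty Ω] (w : κ → ι → Ω → ℝ)
    {i : κ → ι} (hi : Function.Injective i) :
    𝔼 δ : ι → Ω, ∏ j, w j (i j) (δ (i j)) = ∏ j, 𝔼 a, w j (i j) a := by
  have h1 : ∀ δ : ι → Ω, ∏ j, w j (i j) (δ (i j)) =
      ∏ n, ∏ j with i j = n, w j n (δ n) := by
    intro δ
    rw [← Finset.prod_fiberwise (s := Finset.univ) (g := i)]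
    refine Finset.prod_congr rfl fun n _ => Finset.prod_congr rfl fun j hj => ?_
    rw [(Finset.mem_filter.1 hj).2]
  have h2 : ∏ j, 𝔼 a, w j (i j) a = ∏ n, ∏ j with i j = n, 𝔼 a, w j n a := by
    rw [← Finset.prod_fiberwise (s := Finset.univ) (g := i)]
    refine Finset.prod_congr rfl fun n _ => Finset.prod_congr rfl fun j hj => ?_
    rw [(Finset.mem_filter.1 hj).2]
  simp only [h1]
  rw [h2, expect_prod (fun n a => ∏ j with i j = n, w j n a)]
  refine Finset.prod_congr rfl fun n _ => ?_
  -- The fibres of an injective map have at most one element.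
  have hcard : (Finset.univ.filter fun j => i j = n).card ≤ 1 := by
    refine Finset.card_le_one.2 fun a ha b hb => hi ?_
    rw [(Finset.mem_filter.1 ha).2, (Finset.mem_filter.1 hb).2]
  rcases Nat.le_one_iff_eq_zero_or_eq_one.1 hcard with h | h
  · simp [Finset.card_eq_zero.1 h]
  · obtain ⟨j, hj⟩ := Finset.card_eq_one.1 h
    simp [hj]

end Product

section Form

variable {κ ι E : Type*} [Fintype κ] [DecidableEq κ] [Fintype ι]
  [NormedAddCommGroup E] [NormedSpace ℝ E]

/-- The multilinear form `(x_j)_j ↦ ∑ i, (∏ j, x_j (i j)) • F i` of an array `F` whose indices range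
over a finite type `ι`. -/
noncomputable def form (F : (κ → ι) → E) :
    MultilinearMap ℝ (fun _ : κ => ι → ℝ) E :=
  ∑ i : κ → ι, ((MultilinearMap.mkPiAlgebra ℝ κ ℝ).compLinearMap
    fun j => LinearMap.proj (i j)).smulRight (F i)

/-- `F` vanishes at all multi-indices with a repetition. -/
def DiagFree (F : (κ → ι) → E) : Prop := ∀ i : κ → ι, ¬ Function.Injective i → F i = 0

/-- `F` is invariant under permutations of the indices. -/
def Symm (F : (κ → ι) → E) : Prop := ∀ (σ : Equiv.Perm κ) (i : κ → ι), F (fun j => i (σ j)) = F i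

theorem form_apply (F : (κ → ι) → E) (x : κ → ι → ℝ) :
    form F x = ∑ i : κ → ι, (∏ j, x j (i j)) • F i := by
  simp [form]

theorem form_comp_perm {F : (κ → ι) → E} (hF : Symm F) (σ : Equiv.Perm κ) (x : κ → ι → ℝ) :
    form F (fun j => x (σ j)) = form F x := by
  rw [form_apply, form_apply]
  refine (Fintype.sum_equiv (σ.arrowCongr (Equiv.refl ι)).symm _ _ fun i => ?_).symm
  have h1 : (σ.arrowCongr (Equiv.refl ι)).symm i = fun j => i (σ j) := by
    funext j; simp [Equiv.arrowCongr]
  rw [h1, hF, Equiv.prod_comp σ fun j => x j (i j)]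

variable [DecidableEq ι]

/-- Real forms without diagonal, evaluated at vectors with independent coordinates, have the
expected mean. -/
theorem expect_form {Ω : Type*} [Fintype Ω] [Nonempty Ω] {F : (κ → ι) → ℝ} (hF : DiagFree F)
    (w : κ → ι → Ω → ℝ) :
    𝔼 δ : ι → Ω, form F (fun j i => w j i (δ i)) = form F fun j i => 𝔼 a, w j i a := by
  simp only [form_apply, smul_eq_mul]
  rw [Finset.expect_sum_comm]
  refine Finset.sum_congr rfl fun i _ => ?_
  rw [← Finset.expect_mul]
  by_cases hi : Function.Injective i
  · rw [expect_prod_comp_injective w hi]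
  · simp [hF i hi]

theorem lowDeg_form {Ω : Type*} (F : (κ → ι) → ℝ) (w : κ → ι → Ω → ℝ) :
    LowDeg (Fintype.card κ) fun δ : ι → Ω => form F fun j i => w j i (δ i) := by
  simp only [form_apply, smul_eq_mul]
  refine LowDeg.sum _ fun i _ => ?_
  refine lowDeg_of_dependsOn (S := Finset.univ.image i) Finset.card_image_le ?_
  intro δ δ' h
  refine congrArg (· * F i) (Finset.prod_congr rfl fun j _ => ?_)
  rw [h (i j) (by simp)]

/-- The probability with which a form of degree `k` in independent variables with `K` values is
guaranteed to be at least half as large as its mean. -/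
noncomputable def halfProb (k K : ℕ) : ℝ := 1 / (2 * (4 * K : ℝ) ^ (2 * k))

theorem halfProb_pos (k : ℕ) {K : ℕ} (hK : 0 < K) : 0 < halfProb k K := by
  unfold halfProb; positivity

/-- A form without diagonal in independent variables is, with a probability bounded below in terms
of the degree, at least half as large as its mean. Testing against a functional that norms the
mean, this is the Paley–Zygmund inequality for a real form. -/
theorem halfProb_le_pr {Ω : Type*} [Fintype Ω] [Nonempty Ω] {F : (κ → ι) → E} (hF : DiagFree F)
    (w : κ → ι → Ω → ℝ) :
    halfProb (Fintype.card κ) (Fintype.card Ω) ≤ pr fun δ : ι → Ω =>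
      ‖form F fun j i => 𝔼 a, w j i a‖ / 2 ≤ ‖form F fun j i => w j i (δ i)‖ := by
  obtain ⟨g, hg1, hg⟩ := exists_dual_vector'' ℝ (form F fun j i => 𝔼 a, w j i a)
  set F' : (κ → ι) → ℝ := fun i => g (F i)
  have hF' : DiagFree F' := fun i hi => by simp [F', hF i hi]
  have hgF : ∀ x, g (form F x) = form F' x := fun x => by simp [form_apply, F']
  have hK : (1 : ℝ) ≤ Fintype.card Ω := by exact_mod_cast Fintype.card_pos
  have h4 := expect_pow_four_le_of_dependsOn Finset.univ
    (by simpa using dependsOn_univ _) (lowDeg_form F' w)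
  have hpz := pr_half_le_abs_ge _ (one_le_pow₀ (by linarith)) h4
  refine hpz.trans (pr_mono fun δ hδ => ?_)
  rw [expect_form hF', ← hgF, ← hgF, hg] at hδ
  simp only [RCLike.ofReal_real_eq_id, id_eq, abs_norm] at hδ
  refine hδ.trans ?_
  rw [← Real.norm_eq_abs]
  exact (g.le_opNorm _).trans (mul_le_of_le_one_left (norm_nonneg _) hg1)

end Form

/-! ### Lévy's maximal inequality for chains of sets of coordinates -/

section Levy

variable {κ ι L : Type*}

/-- A vector of signs, as a real vector. -/
def sgn (ε : ι → ℤˣ) : ι → ℝ := fun i => ((ε i : ℤ) : ℝ)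

variable [DecidableEq ι]

/-- The truncation of a vector to a set of coordinates. -/
def cut (U : Finset ι) (x : ι → ℝ) : ι → ℝ := fun i => if i ∈ U then x i else 0

/-- Lévy's maximal inequality. The condition on `B` holds for the complement of a symmetric convex
set. -/
theorem levy [Fintype ι] [Finite L] {U : L → Finset ι} (hU : ∀ l l', U l ⊆ U l' ∨ U l' ⊆ U l)
    {B : (ι → ℝ) → Prop} (hB : ∀ x y, B x → B (x + y) ∨ B (x - y)) :
    pr (fun ε : ι → ℤˣ => ∃ l, B (cut (U l) (sgn ε))) ≤ 2 * pr fun ε : ι → ℤˣ => B (sgn ε) := by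
  classical
  -- `W ε` is the first set of the chain where the truncation is in `B`; changing the signs outside
  -- of this set is an involution.
  let W : (ι → ℤˣ) → Finset ι := fun ε =>
    Finset.univ.filter fun i => ∀ l, B (cut (U l) (sgn ε)) → i ∈ U l
  let τ : (ι → ℤˣ) → (ι → ℤˣ) := fun ε i => if i ∈ W ε then ε i else -ε i
  have hW : ∀ ε, (∃ l, B (cut (U l) (sgn ε))) → ∃ l, B (cut (U l) (sgn ε)) ∧ W ε = U l := by
    intro ε h
    have := Fintype.ofFinite L
    obtain ⟨l₀, h₀, hmin⟩ := Finset.exists_min_image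
      (Finset.univ.filter fun l => B (cut (U l) (sgn ε))) (fun l => (U l).card)
      (by obtain ⟨l, hl⟩ := h; exact ⟨l, by simpa using hl⟩)
    simp only [Finset.mem_filter, Finset.mem_univ, true_and] at h₀ hmin
    refine ⟨l₀, h₀, ?_⟩
    ext i
    simp only [W, Finset.mem_filter, Finset.mem_univ, true_and]
    refine ⟨fun hi => hi l₀ h₀, fun hi l hl => ?_⟩
    rcases hU l₀ l with h | h
    · exact h hi
    · rwa [Finset.eq_of_subset_of_card_le h (hmin l hl)]
  have hcut : ∀ ε l, U l ⊆ W ε → cut (U l) (sgn (τ ε)) = cut (U l) (sgn ε) := by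
    intro ε l h
    funext i
    by_cases hi : i ∈ U l
    · simp [cut, hi, sgn, τ, h hi]
    · simp [cut, hi]
  have hWτ : ∀ ε, W (τ ε) = W ε := by
    intro ε
    by_cases h : ∃ l, B (cut (U l) (sgn ε))
    · obtain ⟨l, hl, hWl⟩ := hW ε h
      have hl' : B (cut (U l) (sgn (τ ε))) := by rwa [hcut ε l hWl.ge]
      obtain ⟨l₁, hl₁, hWl₁⟩ := hW (τ ε) ⟨l, hl'⟩
      have h1 : W (τ ε) ⊆ U l := fun i hi => (Finset.mem_filter.1 hi).2 l hl'
      have h2 : U l₁ ⊆ W ε := by rw [← hWl₁, hWl]; exact h1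
      rw [hcut ε l₁ h2] at hl₁
      refine (hWl ▸ h1).antisymm ?_
      rw [hWl₁]
      exact fun i hi => (Finset.mem_filter.1 hi).2 l₁ hl₁
    · have hτ : τ ε = ε := by
        funext i
        have : i ∈ W ε := Finset.mem_filter.2 ⟨Finset.mem_univ _, fun l hl => (h ⟨l, hl⟩).elim⟩
        simp [τ, this]
      rw [hτ]
  have hτ : Function.Involutive τ := by
    intro ε
    funext i
    change (if i ∈ W (τ ε) then τ ε i else -τ ε i) = ε i
    rw [hWτ]
    by_cases hi : i ∈ W ε <;> simp [τ, hi]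
  have hmain : ∀ ε, (∃ l, B (cut (U l) (sgn ε))) → B (sgn ε) ∨ B (sgn (τ ε)) := by
    intro ε h
    obtain ⟨l, hl, hWl⟩ := hW ε h
    have h1 : sgn ε = cut (U l) (sgn ε) + (sgn ε - cut (U l) (sgn ε)) := by abel
    have h2 : sgn (τ ε) = cut (U l) (sgn ε) - (sgn ε - cut (U l) (sgn ε)) := by
      funext i
      by_cases hi : i ∈ U l <;> simp [sgn, cut, τ, hWl, hi]
    rcases hB _ (sgn ε - cut (U l) (sgn ε)) hl with h | h
    · left; rwa [h1]
    · right; rwa [h2]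
  refine (pr_mono hmain).trans ((pr_or_le _ _).trans (le_of_eq ?_))
  have := pr_equiv hτ.toPerm fun ε : ι → ℤˣ => B (sgn ε)
  rw [two_mul]
  congr 1

/-- Lévy's maximal inequality for functions of independent sign vectors `e j`, all of which are
truncated: it is applied to one sign vector at a time. -/
theorem levy_decoupled [Fintype κ] [DecidableEq κ] [Fintype ι] [Finite L] [Nonempty L]
    {U : κ → L → Finset ι}
    (hU : ∀ j l l', U j l ⊆ U j l' ∨ U j l' ⊆ U j l) {B : (κ → ι → ℝ) → Prop}
    (hB : ∀ x j a b, B (Function.update x j a) →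
      B (Function.update x j (a + b)) ∨ B (Function.update x j (a - b))) :
    pr (fun e : κ → ι → ℤˣ => ∃ m : κ → L, B fun j => cut (U j (m j)) (sgn (e j))) ≤
      2 ^ Fintype.card κ * pr fun e : κ → ι → ℤˣ => B fun j => sgn (e j) := by
  let y : Finset κ → (κ → L) → (κ → ι → ℤˣ) → κ → ι → ℝ := fun A m e j =>
    if j ∈ A then cut (U j (m j)) (sgn (e j)) else sgn (e j)
  have main : ∀ A : Finset κ, pr (fun e : κ → ι → ℤˣ => ∃ m, B (y A m e)) ≤
      2 ^ A.card * pr fun e : κ → ι → ℤˣ => B fun j => sgn (e j) := by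
    intro A
    induction A using Finset.induction_on with
    | empty => simp [y]
    | insert j A hj ih =>
      rw [Finset.card_insert_of_notMem hj, pow_succ', mul_assoc]
      refine le_trans ?_ (mul_le_mul_of_nonneg_left ih zero_le_two)
      have fub : ∀ P : (κ → ι → ℤˣ) → Prop,
          pr P = 𝔼 e : κ → ι → ℤˣ, pr fun ε => P (Function.update e j ε) := fun P =>
        expect_update j _
      rw [fub, fub fun e => ∃ m, B (y A m e), Finset.mul_expect]
      refine Finset.expect_le_expect fun e _ => ?_
      let B' : (ι → ℝ) → Prop := fun x => ∃ m, B (Function.update (y A m e) j x)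
      have hB' : ∀ x z, B' x → B' (x + z) ∨ B' (x - z) := by
        rintro x z ⟨m, hm⟩
        exact (hB _ _ _ z hm).imp (fun h => ⟨m, h⟩) fun h => ⟨m, h⟩
      refine (pr_mono ?_).trans ((levy (hU j) hB').trans
        (mul_le_mul_of_nonneg_left (pr_mono ?_) zero_le_two))
      · rintro ε ⟨m, hm⟩
        refine ⟨m j, m, ?_⟩
        convert hm using 1
        funext l
        by_cases hl : l = j
        · subst hl; simp [y]
        · simp [y, hl]
      · rintro ε ⟨m, hm⟩
        refine ⟨m, ?_⟩
        convert hm using 1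
        funext l
        by_cases hl : l = j
        · subst hl; simp [y, hj]
        · simp [y, hl]
  simpa [y] using main Finset.univ

end Levy

/-! ### Decoupling for sign vectors -/

section Decoupling

variable {κ ι E : Type*} [Fintype κ] [DecidableEq κ] [Fintype ι]
  [NormedAddCommGroup E] [NormedSpace ℝ E]

/-- The condition of `levy_decoupled` for the events that the norm of a form exceeds `t`. -/
theorem norm_update_or (F : (κ → ι) → E) (t : ℝ) (x : κ → ι → ℝ) (j : κ) (a b : ι → ℝ)
    (h : t < ‖form F (Function.update x j a)‖) :
    t < ‖form F (Function.update x j (a + b))‖ ∨ t < ‖form F (Function.update x j (a - b))‖ := by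
  by_contra! hcon
  have h2 : (2 : ℝ) • form F (Function.update x j a) =
      form F (Function.update x j (a + b)) + form F (Function.update x j (a - b)) := by
    rw [MultilinearMap.map_update_add, MultilinearMap.map_update_sub, two_smul]; abel
  have h3 := congrArg norm h2
  rw [norm_smul, Real.norm_two] at h3
  have := norm_add_le (form F (Function.update x j (a + b)))
    (form F (Function.update x j (a - b)))
  linarith

theorem norm_form_smul (F : (κ → ι) → E) {c : ℝ} (hc : 0 ≤ c) (x : κ → ι → ℝ) :
    ‖form F fun j => c • x j‖ = c ^ Fintype.card κ * ‖form F x‖ := by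
  rw [MultilinearMap.map_smul_univ (form F) (fun _ => c) x, norm_smul]
  simp [abs_of_nonneg hc]

/-- Averages of products of signs: only permutations contribute to the polarization formula. -/
theorem sum_prod_signs (a : κ → κ) :
    ∑ θ : κ → ℤˣ, (∏ j, sgn θ j) * ∏ j, sgn θ (a j) =
      if Function.Bijective a then 2 ^ Fintype.card κ else 0 := by
  split_ifs with ha
  · have h : ∀ θ : κ → ℤˣ, (∏ j, sgn θ j) * ∏ j, sgn θ (a j) = 1 := by
      intro θ
      rw [Function.Bijective.prod_comp ha (sgn θ), ← Finset.prod_mul_distrib]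
      refine Finset.prod_eq_one fun j _ => ?_
      rcases Int.units_eq_one_or (θ j) with h | h <;> simp [sgn, h]
    simp [h, Fintype.card_units_int]
  · obtain ⟨b, hb⟩ : ∃ b, ∀ j, a j ≠ b := by
      by_contra! hcon
      exact ha ((Finite.injective_iff_surjective.2 hcon).bijective_of_finite)
    -- Changing the sign of `θ b` changes the sign of the summand.
    let e : (κ → ℤˣ) ≃ (κ → ℤˣ) := Equiv.mulLeft (Function.update 1 b (-1))
    have he : ∀ θ j, sgn (e θ) j = (if j = b then -1 else 1) * sgn θ j := by
      intro θ j
      by_cases hj : j = b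
      · subst hj; simp [e, sgn]
      · simp [e, sgn, hj]
    have hneg : ∑ θ : κ → ℤˣ, (∏ j, sgn θ j) * ∏ j, sgn θ (a j) =
        -∑ θ : κ → ℤˣ, (∏ j, sgn θ j) * ∏ j, sgn θ (a j) := by
      rw [← Finset.sum_neg_distrib]
      refine (Fintype.sum_equiv e _ _ fun θ => ?_).symm
      simp only [he, Finset.prod_mul_distrib, hb, if_false, Finset.prod_ite_eq',
        Finset.prod_const_one]
      simp
    linarith

/-- The polarization formula. -/
theorem polarization {F : (κ → ι) → E} (hF : Symm F) (x : κ → ι → ℝ) :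
    ∑ θ : κ → ℤˣ, (∏ j, sgn θ j) • form F (fun _ => ∑ j, sgn θ j • x j) =
      (2 ^ Fintype.card κ * ((Finset.univ.filter
        fun a : κ → κ => Function.Bijective a).card : ℝ)) • form F x := by
  have h1 : ∀ θ : κ → ℤˣ, form F (fun _ => ∑ j, sgn θ j • x j) =
      ∑ a : κ → κ, (∏ j, sgn θ (a j)) • form F fun j => x (a j) := by
    intro θ
    rw [MultilinearMap.map_sum]
    exact Finset.sum_congr rfl fun a _ =>
      MultilinearMap.map_smul_univ (form F) (fun j => sgn θ (a j)) fun j => x (a j)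
  simp only [h1, Finset.smul_sum, smul_smul]
  rw [Finset.sum_comm]
  simp only [← Finset.sum_smul, sum_prod_signs]
  have h2 : ∀ a : κ → κ, (if Function.Bijective a then (2 : ℝ) ^ Fintype.card κ else 0) •
      form F (fun j => x (a j)) =
      (if Function.Bijective a then (2 : ℝ) ^ Fintype.card κ else 0) • form F x := by
    intro a
    split_ifs with ha
    · rw [← form_comp_perm hF (Equiv.ofBijective a ha) x]
      rfl
    · simp
  simp only [h2, ← Finset.sum_smul]
  rw [← Finset.sum_filter, Finset.sum_const, nsmul_eq_mul, mul_comm]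

/-- Some term of the polarization formula is at least as large as the form, as there are `2 ^ k`
terms and the coefficient of the form is at least `2 ^ k`. -/
theorem exists_norm_form_le {F : (κ → ι) → E} (hF : Symm F) (x : κ → ι → ℝ) :
    ∃ θ : κ → ℤˣ, ‖form F x‖ ≤ ‖form F fun _ => ∑ j, sgn θ j • x j‖ := by
  by_contra! hcon
  have hcard : (1 : ℝ) ≤ ((Finset.univ.filter
      fun a : κ → κ => Function.Bijective a).card : ℝ) := by
    exact_mod_cast Finset.card_pos.2 ⟨id, by simp⟩
  have h1 := congrArg norm (polarization hF x)
  rw [norm_smul, Real.norm_of_nonneg (by positivity)] at h1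
  have h2 : ‖∑ θ : κ → ℤˣ, (∏ j, sgn θ j) • form F (fun _ => ∑ j, sgn θ j • x j)‖ ≤
      ∑ θ : κ → ℤˣ, ‖form F (fun _ => ∑ j, sgn θ j • x j)‖ := by
    refine (norm_sum_le _ _).trans (Finset.sum_le_sum fun θ _ => ?_)
    rw [norm_smul, norm_prod]
    refine mul_le_of_le_one_left (norm_nonneg _) (Finset.prod_le_one (fun _ _ => norm_nonneg _) ?_)
    intro j _
    rcases Int.units_eq_one_or (θ j) with h | h <;> simp [sgn, h]
  have h3 : ∑ θ : κ → ℤˣ, ‖form F (fun _ => ∑ j, sgn θ j • x j)‖ <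
      ∑ _θ : κ → ℤˣ, ‖form F x‖ :=
    Finset.sum_lt_sum_of_nonempty Finset.univ_nonempty fun θ _ => hcon θ
  simp only [Finset.sum_const, Finset.card_univ, Fintype.card_fun, Fintype.card_units_int,
    nsmul_eq_mul, Nat.cast_pow, Nat.cast_ofNat] at h3
  have h4 : (2 : ℝ) ^ Fintype.card κ * ‖form F x‖ ≤ 2 ^ Fintype.card κ * ((Finset.univ.filter
      fun a : κ → κ => Function.Bijective a).card : ℝ) * ‖form F x‖ := by
    refine mul_le_mul_of_nonneg_right ?_ (norm_nonneg _)
    exact le_mul_of_one_le_right (by positivity) hcard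
  linarith

variable [DecidableEq ι]

/-- If each coordinate is drawn from one of several independent sign vectors, the result is again a
uniformly distributed sign vector. -/
theorem pr_select (δ : ι → κ) (P : (ι → ℤˣ) → Prop) :
    pr (fun e : κ → ι → ℤˣ => P fun i => e (δ i) i) = pr P :=
  pr_comp_equivariant (fun (e : κ → ι → ℤˣ) i => e (δ i) i)
    (fun θ => Equiv.mulLeft fun _ => θ) (fun _ _ => rfl) P

/-- The constant of the two decoupling inequalities. -/
noncomputable def decConst (k : ℕ) : ℝ := 2 ^ k / halfProb k k

/-- The undecoupled form is dominated by the decoupled one. If every coordinate is assigned at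
random to one of the arguments, the mean over the assignments is `k ^ (-k)` times the undecoupled
form; for a fixed assignment, disjoint parts of one sign vector are distributed like the same parts
of independent ones, and these are truncations. -/
theorem pr_form_le_decoupled [Nonempty κ] {F : (κ → ι) → E} (hF : DiagFree F) (t : ℝ) :
    pr (fun ε : ι → ℤˣ => 2 * (Fintype.card κ : ℝ) ^ Fintype.card κ * t <
        ‖form F fun _ => sgn ε‖) ≤
      decConst (Fintype.card κ) *
        pr fun e : κ → ι → ℤˣ => t < ‖form F fun j => sgn (e j)‖ := by
  have hk : (0 : ℝ) < Fintype.card κ := by exact_mod_cast Fintype.card_pos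
  have hc := halfProb_pos (Fintype.card κ) (Fintype.card_pos (α := κ))
  have h1 := mul_pr_le_expect_pr (c := halfProb (Fintype.card κ) (Fintype.card κ))
    (P := fun ε : ι → ℤˣ => 2 * (Fintype.card κ : ℝ) ^ Fintype.card κ * t <
        ‖form F fun _ => sgn ε‖)
    (R := fun ε (δ : ι → κ) => t < ‖form F fun j i => if δ i = j then sgn ε i else 0‖) <| by
      intro ε hε
      refine (halfProb_le_pr hF fun j i a => if a = j then sgn ε i else 0).trans
        (pr_mono fun δ hδ => lt_of_lt_of_le ?_ hδ)
      have hmean : (fun (j : κ) i => 𝔼 a : κ, if a = j then sgn ε i else 0) =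
          fun _ : κ => (Fintype.card κ : ℝ)⁻¹ • sgn ε := by
        funext j i
        rw [Fintype.expect_eq_sum_div_card]
        simp [div_eq_inv_mul]
      rw [hmean, norm_form_smul F (by positivity), lt_div_iff₀ two_pos, inv_pow,
        lt_inv_mul_iff₀ (by positivity)]
      linarith
  have h2 : ∀ δ : ι → κ, pr (fun ε : ι → ℤˣ =>
      t < ‖form F fun j i => if δ i = j then sgn ε i else 0‖) ≤
      2 ^ Fintype.card κ * pr fun e : κ → ι → ℤˣ => t < ‖form F fun j => sgn (e j)‖ := by
    intro δ
    rw [← pr_select δ]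
    have hl := levy_decoupled (L := Unit) (κ := κ) (ι := ι)
      (U := fun j _ => Finset.univ.filter fun i => δ i = j) (fun _ _ _ => Or.inl le_rfl)
      (B := fun x => t < ‖form F x‖) (norm_update_or F t)
    refine (pr_mono ?_).trans hl
    intro e he
    refine ⟨fun _ => (), ?_⟩
    convert he using 3
    funext j i
    by_cases h : δ i = j
    · simp [cut, sgn, h]
    · simp [cut, h]
  rw [expect_pr_comm] at h1
  have h3 := h1.trans (Finset.expect_le_expect fun δ _ => h2 δ)
  rw [Fintype.expect_const] at h3
  rw [decConst, div_mul_eq_mul_div, le_div_iff₀ hc]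
  linarith

/-- The decoupled form of a symmetric array is dominated by the undecoupled one. By polarization it
is enough to consider the sum of the independent sign vectors, which is `k` times the mean of a
vector whose coordinates are drawn at random from these. -/
theorem pr_decoupled_le_form [Nonempty κ] {F : (κ → ι) → E} (hF : DiagFree F) (hs : Symm F)
    (t : ℝ) :
    pr (fun e : κ → ι → ℤˣ => 2 * (Fintype.card κ : ℝ) ^ Fintype.card κ * t <
        ‖form F fun j => sgn (e j)‖) ≤
      decConst (Fintype.card κ) * pr fun ε : ι → ℤˣ => t < ‖form F fun _ => sgn ε‖ := by
  have hk : (0 : ℝ) < Fintype.card κ := by exact_mod_cast Fintype.card_pos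
  have hc := halfProb_pos (Fintype.card κ) (Fintype.card_pos (α := κ))
  set T := 2 * (Fintype.card κ : ℝ) ^ Fintype.card κ * t
  have h1 := mul_pr_le_expect_pr (c := halfProb (Fintype.card κ) (Fintype.card κ))
    (P := fun e : κ → ι → ℤˣ => T < ‖form F fun _ => ∑ j, sgn (e j)‖)
    (R := fun e (δ : ι → κ) => t < ‖form F fun _ => sgn fun i => e (δ i) i‖) <| by
      intro e he
      refine (halfProb_le_pr hF fun _ i a => sgn (e a) i).trans
        (pr_mono fun δ hδ => lt_of_lt_of_le ?_ hδ)
      have hmean : (fun (_ : κ) i => 𝔼 a : κ, sgn (e a) i) =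
          fun _ : κ => (Fintype.card κ : ℝ)⁻¹ • ∑ j, sgn (e j) := by
        funext j i
        rw [Fintype.expect_eq_sum_div_card]
        simp [div_eq_inv_mul]
      rw [hmean, norm_form_smul F (by positivity), lt_div_iff₀ two_pos, inv_pow,
        lt_inv_mul_iff₀ (by positivity)]
      linarith
  rw [expect_pr_comm] at h1
  simp only [pr_select _ fun ε : ι → ℤˣ => t < ‖form F fun _ => sgn ε‖, Fintype.expect_const] at h1
  have h2 : pr (fun e : κ → ι → ℤˣ => T < ‖form F fun j => sgn (e j)‖) ≤
      ∑ _θ : κ → ℤˣ, pr fun e : κ → ι → ℤˣ => T < ‖form F fun _ => ∑ j, sgn (e j)‖ := by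
    refine (pr_mono fun e he => ?_).trans ((pr_exists_le fun (θ : κ → ℤˣ) (e : κ → ι → ℤˣ) =>
      T < ‖form F fun _ => ∑ j, sgn θ j • sgn (e j)‖).trans
        (Finset.sum_le_sum fun θ _ => le_of_eq ?_))
    · obtain ⟨θ, hθ⟩ := exists_norm_form_le hs fun j => sgn (e j)
      exact ⟨θ, he.trans_le hθ⟩
    · rw [← pr_equiv (Equiv.mulLeft fun (j : κ) (_ : ι) => θ j)]
      congr! 6 with e j
      funext i
      simp only [Finset.sum_apply, Pi.smul_apply, smul_eq_mul]
      refine Finset.sum_congr rfl fun l _ => ?_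
      rcases Int.units_eq_one_or (θ l) with h | h <;> simp [sgn, h]
  simp only [Finset.sum_const, Finset.card_univ, Fintype.card_fun, Fintype.card_units_int,
    nsmul_eq_mul, Nat.cast_pow, Nat.cast_ofNat] at h2
  rw [decConst, div_mul_eq_mul_div, le_div_iff₀ hc]
  have h3 := mul_le_mul_of_nonneg_left h1 (show (0 : ℝ) ≤ 2 ^ Fintype.card κ by positivity)
  nlinarith

theorem decConst_pos {k : ℕ} (hk : 0 < k) : 0 < decConst k :=
  div_pos (by positivity) (halfProb_pos k hk)

/-- The constant of the maximal inequality for symmetric arrays of signs. -/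
noncomputable def maxConst (k : ℕ) : ℝ :=
  max ((2 * (k : ℝ) ^ k) ^ 2) (decConst k * 2 ^ k * decConst k)

/-- The maximal inequality for symmetric forms in signs: all truncations of the arguments to sets
of a chain are considered as one form, with values in a product of copies of `E`. It is decoupled,
Lévy's inequality is applied to each argument, and the resulting form is recoupled. -/
theorem pr_max_cut_le [Nonempty κ] {L : Type*} [Finite L] [Nonempty L] {U : L → Finset ι}
    (hU : ∀ l l', U l ⊆ U l' ∨ U l' ⊆ U l) {F : (κ → ι) → E} (hF : DiagFree F) (hs : Symm F)
    {t : ℝ} (ht : 0 ≤ t) :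
    pr (fun ε : ι → ℤˣ => ∃ m : κ → L, maxConst (Fintype.card κ) * t <
        ‖form F fun j => cut (U (m j)) (sgn ε)‖) ≤
      maxConst (Fintype.card κ) * pr fun ε : ι → ℤˣ => t < ‖form F fun _ => sgn ε‖ := by
  have := Fintype.ofFinite L
  have hk : (0 : ℝ) < Fintype.card κ := by exact_mod_cast Fintype.card_pos
  have hd := decConst_pos (Fintype.card_pos (α := κ))
  classical
  set T := 2 * (Fintype.card κ : ℝ) ^ Fintype.card κ * t with hT
  set T' := 2 * (Fintype.card κ : ℝ) ^ Fintype.card κ * T with hT'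
  have hT0 : 0 ≤ T := by positivity
  let F' : (κ → ι) → (κ → L) → E := fun i m => if ∀ j, i j ∈ U (m j) then F i else 0
  have hF' : DiagFree F' := fun i hi => by funext m; simp [F', hF i hi]
  have hform : ∀ x m, form F' x m = form F fun j => cut (U (m j)) (x j) := by
    intro x m
    rw [form_apply, form_apply, Finset.sum_apply]
    refine Finset.sum_congr rfl fun i _ => ?_
    by_cases h : ∀ j, i j ∈ U (m j)
    · simp [F', h, cut]
    · obtain ⟨j, hj⟩ := not_forall.1 h
      have : ∏ j, cut (U (m j)) (x j) (i j) = 0 :=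
        Finset.prod_eq_zero (Finset.mem_univ j) (by simp [cut, hj])
      simp [F', h, this]
  have hnorm : ∀ {T : ℝ}, 0 ≤ T → ∀ x, T < ‖form F' x‖ ↔
      ∃ m : κ → L, T < ‖form F fun j => cut (U (m j)) (x j)‖ := by
    intro T hT x
    rw [← not_le, pi_norm_le_iff_of_nonneg hT]
    simp [hform]
  have e1 := pr_form_le_decoupled hF' T
  have e2 := levy_decoupled (fun _ : κ => hU) (B := fun x => T < ‖form F x‖) (norm_update_or F T)
  have e3 := pr_decoupled_le_form hF hs t
  simp only [hnorm hT0] at e1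
  rw [← hT'] at e1
  simp only [hnorm (show 0 ≤ T' by positivity)] at e1
  refine (pr_mono ?_).trans ((e1.trans (mul_le_mul_of_nonneg_left (e2.trans
    (mul_le_mul_of_nonneg_left e3 (by positivity))) hd.le)).trans ?_)
  · rintro ε ⟨m, hm⟩
    refine ⟨m, lt_of_le_of_lt ?_ hm⟩
    rw [hT', hT, ← mul_assoc, ← sq]
    exact mul_le_mul_of_nonneg_right (le_max_left _ _) ht
  · rw [← mul_assoc, ← mul_assoc]
    exact mul_le_mul_of_nonneg_right (le_max_right _ _) (pr_nonneg _)

theorem maxConst_pos (k : ℕ) : 0 < maxConst k := by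
  refine lt_max_of_lt_left ?_
  rcases k.eq_zero_or_pos with rfl | h
  · norm_num
  · positivity

end Decoupling

/-! ### Symmetrization and contraction for sign vectors -/

theorem prod_comp_perm {κ ι : Type*} [Fintype κ] (x : ι → ℝ) (σ : Equiv.Perm κ) (i : κ → ι) :
    ∏ j, x (i (σ j)) = ∏ j, x (i j) := Equiv.prod_comp σ fun j => x (i j)

section Symmetrization

variable {κ ι E : Type*} [Fintype κ] [DecidableEq κ] [NormedAddCommGroup E]

/-- The sum of an array over all permutations of its indices (not divided by their number). -/
def symz (F : (κ → ι) → E) : (κ → ι) → E := fun i =>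
  ∑ σ : Equiv.Perm κ, F fun j => i (σ j)

theorem symm_symz (F : (κ → ι) → E) : Symm (symz F) := fun σ _ =>
  Fintype.sum_equiv (Equiv.mulLeft σ) _ _ fun _ => rfl

theorem diagFree_symz {F : (κ → ι) → E} (hF : DiagFree F) : DiagFree (symz F) := fun _ hi =>
  Finset.sum_eq_zero fun σ _ => hF _ fun h =>
    hi ((Function.Injective.of_comp_iff' _ σ.bijective).1 h)

variable [Fintype ι] [NormedSpace ℝ E]

theorem sum_smul_symz (F : (κ → ι) → E) {h : (κ → ι) → ℝ}
    (hh : ∀ (σ : Equiv.Perm κ) i, h (fun j => i (σ j)) = h i) :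
    ∑ i, h i • symz F i = ((Fintype.card κ).factorial : ℝ) • ∑ i, h i • F i := by
  have h1 : ∀ σ : Equiv.Perm κ, ∑ i : κ → ι, h i • F (fun j => i (σ j)) = ∑ i, h i • F i := by
    intro σ
    refine Fintype.sum_equiv (σ.arrowCongr (Equiv.refl ι)).symm _ _ fun i => ?_
    have h1 : (σ.arrowCongr (Equiv.refl ι)).symm i = fun j => i (σ j) := by
      funext j; simp [Equiv.arrowCongr]
    rw [h1, hh]
  simp only [symz, Finset.smul_sum]
  rw [Finset.sum_comm]
  simp only [h1, ← Finset.smul_sum, Finset.sum_const, Finset.card_univ, Fintype.card_perm,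
    Nat.cast_smul_eq_nsmul]

theorem norm_form_symz (F : (κ → ι) → E) (x : ι → ℝ) :
    ‖form (symz F) fun _ => x‖ = (Fintype.card κ).factorial * ‖form F fun _ => x‖ := by
  rw [form_apply, form_apply, sum_smul_symz F fun σ i => prod_comp_perm x σ i, norm_smul]
  simp

/-- The events for a form and for its symmetrization coincide; the factor is the number of
permutations in `symz`. -/
theorem lt_norm_form_symz (F : (κ → ι) → E) (x : ι → ℝ) (t : ℝ) :
    (Fintype.card κ).factorial * t < ‖form (symz F) fun _ => x‖ ↔ t < ‖form F fun _ => x‖ := by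
  rw [norm_form_symz]
  exact mul_lt_mul_iff_right₀ (by exact_mod_cast Nat.factorial_pos _)

variable [DecidableEq ι] [CompleteSpace E]

/-- Layer-cake representation: `∏ j, s (i j)` is the volume of the set of `u ∈ [0, 1] ^ k` with
`u j ≤ s (i j)` for all `j`, so that the form at `s x` is an average of its values at truncations
of `x` to superlevel sets of `s`. -/
theorem norm_form_mul_le (F : (κ → ι) → E) {s : ι → ℝ} (h0 : ∀ i, 0 ≤ s i) (h1 : ∀ i, s i ≤ 1)
    (x : ι → ℝ) {B : ℝ}
    (hB : ∀ u : κ → ℝ,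
      ‖form F fun j => cut (Finset.univ.filter fun i => u j ≤ s i) x‖ ≤ B) :
    ‖form F fun _ i => s i * x i‖ ≤ B := by
  let ν : Measure ℝ := volume.restrict (Set.Ioc 0 1)
  have hν : IsProbabilityMeasure ν := ⟨by simp [ν]⟩
  have hνs : ∀ i, ν.real (Set.Iic (s i)) = s i := by
    intro i
    rw [measureReal_def, Measure.restrict_apply measurableSet_Iic]
    have : Set.Iic (s i) ∩ Set.Ioc 0 1 = Set.Ioc 0 (s i) := by
      ext r
      simp only [Set.mem_inter_iff, Set.mem_Iic, Set.mem_Ioc]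
      exact ⟨fun h => ⟨h.2.1, h.1⟩, fun h => ⟨h.2, h.1, h.2.trans (h1 i)⟩⟩
    rw [this, Real.volume_Ioc, sub_zero, ENNReal.toReal_ofReal (h0 i)]
  let π : Measure (κ → ℝ) := Measure.pi fun _ => ν
  let box : (κ → ι) → Set (κ → ℝ) := fun i => Set.univ.pi fun j => Set.Iic (s (i j))
  have hbox : ∀ i, MeasurableSet (box i) := fun i =>
    MeasurableSet.univ_pi fun j => measurableSet_Iic
  have hπ : ∀ i, π.real (box i) = ∏ j, s (i j) := by
    intro i
    rw [measureReal_def, Measure.pi_pi, ENNReal.toReal_prod]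
    exact Finset.prod_congr rfl fun j _ => hνs (i j)
  have hint : ∀ i : κ → ι, Integrable
      ((box i).indicator fun _ => (∏ j, x (i j)) • F i) π := fun i =>
    (integrable_const _).indicator (hbox i)
  have hsum : form F (fun _ i => s i * x i) =
      ∫ u, ∑ i, (box i).indicator (fun _ => (∏ j, x (i j)) • F i) u ∂π := by
    rw [integral_finsetSum _ fun i _ => hint i, form_apply]
    refine Finset.sum_congr rfl fun i _ => ?_
    rw [integral_indicator_const _ (hbox i), hπ, smul_smul, Finset.prod_mul_distrib]
  have hval : ∀ u, ∑ i, (box i).indicator (fun _ => (∏ j, x (i j)) • F i) u =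
      form F fun j => cut (Finset.univ.filter fun i => u j ≤ s i) x := by
    intro u
    rw [form_apply]
    refine Finset.sum_congr rfl fun i _ => ?_
    by_cases hu : ∀ j, u j ≤ s (i j)
    · rw [Set.indicator_of_mem (by rwa [Set.mem_univ_pi])]
      simp [cut, hu]
    · rw [Set.indicator_of_notMem (by rwa [Set.mem_univ_pi])]
      obtain ⟨j, hj⟩ := not_forall.1 hu
      rw [Finset.prod_eq_zero (Finset.mem_univ j) (by simp [cut, hj]), zero_smul]
  rw [hsum]
  refine (norm_integral_le_of_norm_le_const (C := B)
    (Filter.Eventually.of_forall fun u => ?_)).trans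
    (by simp)
  rw [hval]
  exact hB u

/-- The contraction inequality for sign vectors. -/
theorem pr_contraction [Nonempty κ] {F : (κ → ι) → E} (hF : DiagFree F) {s : ι → ℝ}
    (hs : ∀ i, |s i| ≤ 1) {t : ℝ} (ht : 0 ≤ t) :
    pr (fun ε : ι → ℤˣ => maxConst (Fintype.card κ) * t <
        ‖form F fun _ i => s i * sgn ε i‖) ≤
      maxConst (Fintype.card κ) * pr fun ε : ι → ℤˣ => t < ‖form F fun _ => sgn ε‖ := by
  classical
  set n : ℝ := ((Fintype.card κ).factorial : ℝ) with hn
  have hn0 : 0 ≤ n := by positivity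
  -- The signs of `s` do not change the distribution.
  let θ : ι → ℤˣ := fun i => if 0 ≤ s i then 1 else -1
  have hθ : ∀ (ε : ι → ℤˣ) i, s i * sgn (θ * ε) i = |s i| * sgn ε i := by
    intro ε i
    by_cases h : 0 ≤ s i
    · simp [θ, sgn, h, abs_of_nonneg h]
    · simp [θ, sgn, h, abs_of_neg (not_le.1 h)]
  rw [← pr_equiv (Equiv.mulLeft θ)]
  simp only [Equiv.coe_mulLeft, hθ]
  let 𝒰 : Set (Finset ι) := Set.range fun u : ℝ => Finset.univ.filter fun i => u ≤ |s i|
  have h𝒰 : ∀ V W : 𝒰, (V : Finset ι) ⊆ W ∨ (W : Finset ι) ⊆ V := by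
    rintro ⟨_, u, rfl⟩ ⟨_, v, rfl⟩
    rcases le_total u v with h | h
    · exact Or.inr (Finset.monotone_filter_right _ fun i _ hi => h.trans hi)
    · exact Or.inl (Finset.monotone_filter_right _ fun i _ hi => h.trans hi)
  have : Nonempty 𝒰 := ⟨⟨_, 0, rfl⟩⟩
  have hmax := pr_max_cut_le h𝒰 (diagFree_symz hF) (symm_symz F) (mul_nonneg hn0 ht)
  simp only [hn, lt_norm_form_symz] at hmax
  refine (pr_mono fun ε hε => ?_).trans hmax
  by_contra! hcon
  have := norm_form_mul_le (symz F) (fun i => abs_nonneg (s i)) hs (sgn ε) fun u =>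
    hcon fun j => ⟨_, u j, rfl⟩
  rw [mul_left_comm] at this
  exact absurd ((lt_norm_form_symz F _ _).2 hε) (not_lt.2 this)

end Symmetrization

/-! ### Tetrahedral arrays -/

section Tetrahedral

/-- Möbius inversion on the lattice of finite sets. -/
theorem exists_eq_sum_powerset {α : Type*} [DecidableEq α] (φ : Finset α → ℝ) :
    ∃ c : Finset α → ℝ, ∀ B, φ B = ∑ A ∈ B.powerset, c A := by
  let c : Finset α → ℝ := Finset.strongInduction fun B c =>
    φ B - ∑ A ∈ B.ssubsets.attach, c A.1 (Finset.mem_ssubsets.1 A.2)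
  refine ⟨c, fun B => ?_⟩
  have hc : c B = φ B - ∑ A ∈ B.ssubsets, c A := by
    rw [← Finset.sum_attach]
    exact Finset.strongInduction_eq _ B
  rw [← Finset.insert_erase (Finset.mem_powerset_self B),
    Finset.sum_insert (Finset.notMem_erase _ _)]
  change φ B = c B + ∑ A ∈ B.ssubsets, c A
  rw [hc]; ring

open Classical in
/-- Given the set `B` of the pairs `(a, j)` for which the `a`-th index is at most the `j`-th
threshold, this is `1` if the increasing rearrangement of the indices stays below the thresholds,
that is, if at least `j + 1` indices are at most the `j`-th threshold for all `j`. -/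
noncomputable def sortedBelow (k : ℕ) (B : Finset (Fin k × Fin k)) : ℝ :=
  if ∀ j : Fin k, (j : ℕ) < (Finset.univ.filter fun a => (a, j) ∈ B).card then 1 else 0

/-- Coefficients that express `sortedBelow` as a polynomial in the indicators of `(a, j) ∈ B`. -/
noncomputable def sortedCoeff (k : ℕ) : Finset (Fin k × Fin k) → ℝ :=
  (exists_eq_sum_powerset (sortedBelow k)).choose

theorem sortedBelow_eq (k : ℕ) (B : Finset (Fin k × Fin k)) :
    sortedBelow k B = ∑ A ∈ B.powerset, sortedCoeff k A :=
  (exists_eq_sum_powerset (sortedBelow k)).choose_spec B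

/-- The sum of the absolute values of the coefficients, increased by `1`. -/
noncomputable def sortedConst (k : ℕ) : ℝ := 1 + ∑ A, |sortedCoeff k A|

theorem one_le_sortedConst (k : ℕ) : 1 ≤ sortedConst k :=
  le_add_of_nonneg_right (Finset.sum_nonneg fun _ _ => abs_nonneg _)

/-- A chain that contains the whole index set is closed under finite intersections, including the
empty one. -/
theorem exists_inf_chain {ι L : Type*} [Fintype ι] {U : L → Finset ι}
    (hU : ∀ l l', U l ⊆ U l' ∨ U l' ⊆ U l) (htop : ∃ l, U l = Finset.univ)
    {α : Type*} (s : Finset α) (m : α → L) :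
    ∃ l, ∀ n, n ∈ U l ↔ ∀ j ∈ s, n ∈ U (m j) := by
  classical
  induction s using Finset.induction_on with
  | empty => obtain ⟨l, hl⟩ := htop; exact ⟨l, by simp [hl]⟩
  | insert a s _ ih =>
    obtain ⟨l, hl⟩ := ih
    rcases hU l (m a) with h | h
    · refine ⟨l, fun n => ⟨fun hn => ?_, fun hn => ?_⟩⟩
      · simpa [h hn] using (hl n).1 hn
      · exact (hl n).2 fun j hj => hn j (by simp [hj])
    · refine ⟨m a, fun n => ⟨fun hn => ?_, fun hn => hn a (by simp)⟩⟩
      simpa [hn] using (hl n).1 (h hn)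

/-- For increasing indices and lower sets, the indices below a threshold form an initial segment of
`Fin k`, which has more than `j` elements if and only if it contains `j`. -/
theorem sortedBelow_of_strictMono {k : ℕ} {ι L : Type*} [LinearOrder ι] {U : L → Finset ι}
    (hlow : ∀ l, IsLowerSet (U l : Set ι))
    (m : Fin k → L) {i : Fin k → ι} (hi : StrictMono i) :
    sortedBelow k (Finset.univ.filter fun p => i p.1 ∈ U (m p.2)) =
      if ∀ j, i j ∈ U (m j) then 1 else 0 := by
  unfold sortedBelow
  refine if_congr (forall_congr' fun j => ?_) rfl rfl
  simp only [Finset.mem_filter, Finset.mem_univ, true_and]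
  constructor
  · intro h
    by_contra hj
    refine absurd h (not_lt.2 ?_)
    refine (Finset.card_le_card (t := Finset.Iio j) fun a ha => ?_).trans (by simp)
    rw [Finset.mem_Iio]
    by_contra haj
    exact hj (hlow _ (hi.monotone (not_lt.1 haj)) (Finset.mem_filter.1 ha).2)
  · intro h
    refine lt_of_lt_of_le ?_ (Finset.card_le_card (s := Finset.Iic j) fun a ha => ?_)
    · simp
    · exact Finset.mem_filter.2 ⟨Finset.mem_univ _, hlow _ (hi.monotone (Finset.mem_Iic.1 ha)) h⟩

variable {k : ℕ} {ι L E : Type*} [Fintype ι] [LinearOrder ι]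
  [NormedAddCommGroup E] [NormedSpace ℝ E]

/-- Every truncation of a tetrahedral form is a linear combination of truncations of its
symmetrization, with coefficients that depend only on the degree. -/
theorem norm_form_cut_le_of_tetrahedral {U : L → Finset ι}
    (hU : ∀ l l', U l ⊆ U l' ∨ U l' ⊆ U l) (hlow : ∀ l, IsLowerSet (U l : Set ι))
    (htop : ∃ l, U l = Finset.univ) {F : (Fin k → ι) → E}
    (hF : ∀ i, ¬ StrictMono i → F i = 0) (x : ι → ℝ) {B : ℝ}
    (hB : ∀ m : Fin k → L, ‖form (symz F) fun j => cut (U (m j)) x‖ ≤ B) (m : Fin k → L) :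
    ‖form F fun j => cut (U (m j)) x‖ ≤ sortedConst k * B := by
  classical
  have hB0 : 0 ≤ B := (norm_nonneg _).trans (hB m)
  let S : (Fin k → ι) → Finset (Fin k × Fin k) := fun i =>
    Finset.univ.filter fun p => i p.1 ∈ U (m p.2)
  let h : (Fin k → ι) → ℝ := fun i => sortedBelow k (S i) * ∏ j, x (i j)
  -- `h` is symmetric and restricts to the truncated monomial where `i` is increasing, so that
  -- `∑ h F` is the truncated form and, up to `k!`, the same sum for the symmetrization.
  have hh : ∀ (σ : Equiv.Perm (Fin k)) i, h (fun j => i (σ j)) = h i := by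
    intro σ i
    simp only [h, prod_comp_perm]
    congr 1
    unfold sortedBelow
    refine if_congr (forall_congr' fun j => ?_) rfl rfl
    have : (Finset.univ.filter fun a => (a, j) ∈ S fun j => i (σ j)).card =
        (Finset.univ.filter fun a => (a, j) ∈ S i).card :=
      Finset.card_equiv σ fun a => by simp [S]
    rw [this]
  have h1 : form F (fun j => cut (U (m j)) x) = ∑ i, h i • F i := by
    rw [form_apply]
    refine Finset.sum_congr rfl fun i _ => ?_
    by_cases hi : StrictMono i
    · simp only [h, S, sortedBelow_of_strictMono hlow m hi]
      congr 1
      by_cases hm : ∀ j, i j ∈ U (m j)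
      · simp [cut, hm]
      · obtain ⟨j, hj⟩ := not_forall.1 hm
        rw [Finset.prod_eq_zero (Finset.mem_univ j) (by simp [cut, hj]), if_neg hm, zero_mul]
    · simp [hF i hi]
  -- Expanding `sortedBelow` leaves sums in which the `a`-th index runs over an intersection of sets
  -- of the chain, that is, truncations of the symmetric form.
  have h2 : ∑ i, h i • symz F i =
      ∑ A, sortedCoeff k A • ∑ i, (if A ⊆ S i then ∏ j, x (i j) else 0) • symz F i := by
    simp only [Finset.smul_sum, smul_smul]
    rw [Finset.sum_comm]
    refine Finset.sum_congr rfl fun i _ => ?_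
    rw [← Finset.sum_smul]
    congr 1
    simp only [h, sortedBelow_eq, Finset.sum_mul, mul_ite, mul_zero]
    rw [← Finset.sum_filter]
    exact Finset.sum_congr (by ext A; simp) fun _ _ => rfl
  have h3 : ∀ A : Finset (Fin k × Fin k),
      ‖∑ i, (if A ⊆ S i then ∏ j, x (i j) else 0) • symz F i‖ ≤ B := by
    intro A
    choose m' hm' using fun a : Fin k => exists_inf_chain hU htop
      (Finset.univ.filter fun j => (a, j) ∈ A) m
    refine le_of_eq_of_le ?_ (hB m')
    rw [form_apply]
    congr 1
    refine Finset.sum_congr rfl fun i _ => congrArg (· • symz F i) ?_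
    split_ifs with hA
    · refine Finset.prod_congr rfl fun a _ => ?_
      have : i a ∈ U (m' a) := (hm' a _).2 fun j hj => by
        simpa [S] using hA (Finset.mem_filter.1 hj).2
      simp [cut, this]
    · obtain ⟨⟨a, j⟩, hp, hpS⟩ := Finset.not_subset.1 hA
      have : i a ∉ U (m' a) := fun hia => hpS <| by
        simpa [S] using (hm' a _).1 hia j (by simpa using hp)
      exact (Finset.prod_eq_zero (Finset.mem_univ a) (by simp [cut, this])).symm
  have h4 : ‖∑ i, h i • symz F i‖ ≤ sortedConst k * B := by
    rw [h2]
    refine (norm_sum_le _ _).trans ?_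
    have : ∑ A, ‖sortedCoeff k A • ∑ i, (if A ⊆ S i then ∏ j, x (i j) else 0) • symz F i‖ ≤
        ∑ A, |sortedCoeff k A| * B := by
      refine Finset.sum_le_sum fun A _ => ?_
      rw [norm_smul, Real.norm_eq_abs]
      exact mul_le_mul_of_nonneg_left (h3 A) (abs_nonneg _)
    refine this.trans ?_
    rw [← Finset.sum_mul]
    exact mul_le_mul_of_nonneg_right (by simp [sortedConst]) hB0
  rw [h1]
  refine le_trans ?_ h4
  rw [sum_smul_symz F hh, norm_smul]
  refine le_mul_of_one_le_left (norm_nonneg _) ?_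
  simp only [Real.norm_natCast, Nat.one_le_cast]
  exact Nat.factorial_pos _

/-- The constant of the maximal inequality for symmetric and tetrahedral arrays. -/
noncomputable def tetConst (k : ℕ) : ℝ := sortedConst k * (maxConst k * k.factorial)

theorem maxConst_le_tetConst (k : ℕ) : maxConst k ≤ tetConst k := by
  have h1 : (1 : ℝ) ≤ k.factorial := by exact_mod_cast Nat.factorial_pos _
  have h2 := le_mul_of_one_le_right (maxConst_pos k).le h1
  exact h2.trans (le_mul_of_one_le_left ((maxConst_pos k).le.trans h2) (one_le_sortedConst k))

/-- The maximal inequality for sign vectors. -/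
theorem pr_max_cut_le_of_symm_or_tetrahedral (hk : 0 < k) [Finite L] {U : L → Finset ι}
    (hU : ∀ l l', U l ⊆ U l' ∨ U l' ⊆ U l) (hlow : ∀ l, IsLowerSet (U l : Set ι))
    (htop : ∃ l, U l = Finset.univ) {F : (Fin k → ι) → E} (hF : DiagFree F)
    (h : Symm F ∨ ∀ i, ¬ StrictMono i → F i = 0) {t : ℝ} (ht : 0 ≤ t) :
    pr (fun ε : ι → ℤˣ => ∃ m : Fin k → L, tetConst k * t <
        ‖form F fun j => cut (U (m j)) (sgn ε)‖) ≤
      tetConst k * pr fun ε : ι → ℤˣ => t < ‖form F fun _ => sgn ε‖ := by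
  have : Nonempty (Fin k) := ⟨⟨0, hk⟩⟩
  have : Nonempty L := htop.nonempty
  have hle := maxConst_le_tetConst k
  rcases h with h | h
  · have hmax := pr_max_cut_le hU hF h ht
    rw [Fintype.card_fin] at hmax
    refine (pr_mono ?_).trans (hmax.trans (mul_le_mul_of_nonneg_right hle (pr_nonneg _)))
    rintro ε ⟨m, hm⟩
    exact ⟨m, (mul_le_mul_of_nonneg_right hle ht).trans_lt hm⟩
  · have hmax := pr_max_cut_le hU (diagFree_symz hF) (symm_symz F)
      (mul_nonneg (Nat.cast_nonneg (Fintype.card (Fin k)).factorial) ht)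
    simp only [lt_norm_form_symz] at hmax
    rw [Fintype.card_fin] at hmax
    refine (pr_mono ?_).trans (hmax.trans (mul_le_mul_of_nonneg_right hle (pr_nonneg _)))
    rintro ε ⟨m, hm⟩
    by_contra! hcon
    refine absurd hm (not_lt.2 ?_)
    rw [tetConst, mul_assoc, mul_assoc]
    exact norm_form_cut_le_of_tetrahedral hU hlow htop h (sgn ε) hcon m

end Tetrahedral

/-! ### Reduction to random signs of fixed numbers -/

section Conditioning

/-- Extension of a finite vector of signs by `1`. -/
def extSgn {N : ℕ} (θ : Fin N → ℤˣ) (n : ℕ) : ℝ := if h : n < N then sgn θ ⟨n, h⟩ else 1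

theorem extSgn_coe {N : ℕ} (θ : Fin N → ℤˣ) (n : Fin N) : extSgn θ n = sgn θ n := by
  simp [extSgn]

theorem extSgn_eq {N : ℕ} (θ : Fin N → ℤˣ) (n : ℕ) : extSgn θ n = 1 ∨ extSgn θ n = -1 := by
  unfold extSgn
  split_ifs with h
  · rcases Int.units_eq_one_or (θ ⟨n, h⟩) with h | h <;> simp [sgn, h]
  · simp

variable {Ω : Type*} [MeasurableSpace Ω] {μ : Measure Ω} [IsProbabilityMeasure μ] {ξ : ℕ → Ω → ℝ}

theorem IsSymmIndep.map_mul_eq (hξ : IsSymmIndep μ ξ) {a : ℕ → ℝ} (ha : ∀ n, a n = 1 ∨ a n = -1) :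
    μ.map (fun ω n => a n * ξ n ω) = μ.map fun ω n => ξ n ω := by
  have hm : ∀ n, Measurable fun ω => a n * ξ n ω := fun n => (hξ.measurable n).const_mul _
  have hind : iIndepFun (fun n ω => a n * ξ n ω) μ :=
    hξ.indep.comp (fun n r => a n * r) fun n => measurable_const_mul _
  rw [(iIndepFun_iff_map_fun_eq_infinitePi_map hm).1 hind,
    (iIndepFun_iff_map_fun_eq_infinitePi_map hξ.measurable).1 hξ.indep]
  congr 1
  funext n
  rcases ha n with h | h
  · simp [h]
  · simpa [h] using (hξ.symm n).map_eq

open Classical in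
theorem IsSymmIndep.measureReal_eq_integral_pr (hξ : IsSymmIndep μ ξ) (N : ℕ) {A : Set (ℕ → ℝ)}
    (hA : MeasurableSet A) :
    Integrable (fun ω => pr fun θ : Fin N → ℤˣ => (fun n => extSgn θ n * ξ n ω) ∈ A) μ ∧
    μ.real {ω | (fun n => ξ n ω) ∈ A} =
      ∫ ω, pr (fun θ : Fin N → ℤˣ => (fun n => extSgn θ n * ξ n ω) ∈ A) ∂μ := by
  have hX : ∀ θ : Fin N → ℤˣ, Measurable fun ω n => extSgn θ n * ξ n ω := fun θ =>
    measurable_pi_lambda _ fun n => (hξ.measurable n).const_mul _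
  have hS : ∀ θ : Fin N → ℤˣ, MeasurableSet {ω | (fun n => extSgn θ n * ξ n ω) ∈ A} := fun θ =>
    hX θ hA
  have hlaw : ∀ θ : Fin N → ℤˣ, μ.real {ω | (fun n => ξ n ω) ∈ A} =
      ∫ ω, (if (fun n => extSgn θ n * ξ n ω) ∈ A then 1 else 0) ∂μ := by
    intro θ
    have h1 : μ.real {ω | (fun n => ξ n ω) ∈ A} =
        μ.real {ω | (fun n => extSgn θ n * ξ n ω) ∈ A} := by
      have := congrArg (fun ν => ν A) (hξ.map_mul_eq (extSgn_eq θ))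
      beta_reduce at this
      rw [Measure.map_apply (hX θ) hA,
        Measure.map_apply (measurable_pi_lambda _ hξ.measurable) hA] at this
      exact congrArg ENNReal.toReal this.symm
    rw [h1, ← integral_indicator_one (hS θ)]
    rfl
  have hint : ∀ θ : Fin N → ℤˣ, Integrable
      (fun ω => if (fun n => extSgn θ n * ξ n ω) ∈ A then (1 : ℝ) else 0) μ := fun θ =>
    (integrable_const (1 : ℝ)).indicator (hS θ)
  simp only [pr, Fintype.expect_eq_sum_div_card]
  refine ⟨(integrable_finsetSum _ fun θ _ => hint θ).div_const _, ?_⟩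
  rw [integral_div, integral_finsetSum _ fun θ _ => hint θ,
    ← Finset.sum_congr rfl fun θ _ => hlaw θ,
    ← Fintype.expect_eq_sum_div_card, Fintype.expect_const]

/-- The law of independent symmetric variables is unchanged by deterministic changes of signs, so
that an inequality between probabilities follows from the one for randomly signed fixed numbers. -/
theorem IsSymmIndep.measureReal_le (hξ : IsSymmIndep μ ξ) (N : ℕ) {A B : Set (ℕ → ℝ)}
    (hA : MeasurableSet A) (hB : MeasurableSet B) {c : ℝ}
    (h : ∀ x : ℕ → ℝ, pr (fun θ : Fin N → ℤˣ => (fun n => extSgn θ n * x n) ∈ A) ≤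
      c * pr fun θ : Fin N → ℤˣ => (fun n => extSgn θ n * x n) ∈ B) :
    μ.real {ω | (fun n => ξ n ω) ∈ A} ≤ c * μ.real {ω | (fun n => ξ n ω) ∈ B} := by
  obtain ⟨hiA, hA⟩ := hξ.measureReal_eq_integral_pr N hA
  obtain ⟨hiB, hB⟩ := hξ.measureReal_eq_integral_pr N hB
  rw [hA, hB, ← integral_const_mul]
  exact integral_mono hiA (hiB.const_mul c) fun ω => h fun n => ξ n ω

end Conditioning

/-! ### Finitely supported arrays -/

section FinArrays

variable {k : ℕ} {E : Type*} [NormedAddCommGroup E] [NormedSpace ℝ E]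

/-- The restriction of an array to indices less than `N`, multiplied by the products
`x_{i₁} ⋯ x_{i_k}`. -/
def restr (f : FinArray k E) (N : ℕ) (x : ℕ → ℝ) (i : Fin k → Fin N) : E :=
  (∏ j, x (i j)) • f fun j => (i j : ℕ)

theorem exists_support_lt {E : Type*} [Zero E] (f : FinArray k E) :
    ∃ N : ℕ, ∀ i ∈ f.support, ∀ j, i j < N := by
  refine ⟨(f.support.sup fun i => Finset.univ.sup i) + 1, fun i hi j => Nat.lt_succ_of_le ?_⟩
  exact (Finset.le_sup (f := i) (Finset.mem_univ j)).trans
    (Finset.le_sup (f := fun i : Fin k → ℕ => Finset.univ.sup i) hi)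

theorem sum_support_eq {f : FinArray k E} {N : ℕ} (hN : ∀ i ∈ f.support, ∀ j, i j < N)
    (h : (Fin k → ℕ) → ℝ) :
    ∑ i ∈ f.support, h i • f i =
      ∑ i : Fin k → Fin N, h (fun j => i j) • f fun j => (i j : ℕ) := by
  let e : (Fin k → Fin N) ↪ (Fin k → ℕ) :=
    ⟨fun i j => i j, fun i i' h => funext fun j => Fin.ext (congrFun h j)⟩
  have hmap : ∑ i : Fin k → Fin N, h (fun j => i j) • f (fun j => (i j : ℕ)) =
      ∑ i ∈ Finset.univ.map e, h i • f i := (Finset.sum_map Finset.univ e fun i => h i • f i).symm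
  rw [hmap]
  refine Finset.sum_subset (fun i hi => ?_) fun i _ hi => ?_
  · exact Finset.mem_map.2 ⟨fun j => ⟨i j, hN i hi j⟩, Finset.mem_univ _, rfl⟩
  · rw [Finsupp.notMem_support_iff.1 hi, smul_zero]

theorem Q_eq_form {f : FinArray k E} {N : ℕ} (hN : ∀ i ∈ f.support, ∀ j, i j < N)
    (s x : ℕ → ℝ) (θ : Fin N → ℤˣ) :
    Q f (fun _ n => s n * (extSgn θ n * x n)) =
      form (restr f N x) fun _ n => s n * sgn θ n := by
  rw [Q, sum_support_eq hN fun i => ∏ j, s (i j) * (extSgn θ (i j) * x (i j)), form_apply]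
  refine Finset.sum_congr rfl fun i _ => ?_
  rw [restr, smul_smul, ← Finset.prod_mul_distrib]
  simp only [extSgn_coe, mul_assoc]

theorem T_eq_form {f : FinArray k E} {N : ℕ} (hN : ∀ i ∈ f.support, ∀ j, i j < N)
    (m : Fin k → ℕ) (x : ℕ → ℝ) (θ : Fin N → ℤˣ) :
    T m f (fun _ n => extSgn θ n * x n) =
      form (restr f N x) fun j => cut (Finset.univ.filter fun n : Fin N => (n : ℕ) ≤ m j)
        (sgn θ) := by
  have h1 := sum_support_eq hN fun i =>
    if ∀ j, i j ≤ m j then ∏ j, extSgn θ (i j) * x (i j) else 0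
  simp only [ite_smul, zero_smul] at h1
  rw [T, Finset.sum_filter, h1, form_apply]
  refine Finset.sum_congr rfl fun i _ => ?_
  split_ifs with h
  · rw [restr, smul_smul, ← Finset.prod_mul_distrib]
    simp [cut, h, extSgn_coe]
  · obtain ⟨j, hj⟩ := not_forall.1 h
    rw [Finset.prod_eq_zero (Finset.mem_univ j) (by simp [cut, hj]), zero_smul]

theorem diagFree_restr {f : FinArray k E} (hf : DiagonalFree f) (N : ℕ) (x : ℕ → ℝ) :
    DiagFree (restr f N x) := by
  intro i hi
  obtain ⟨a, b, hab, hne⟩ := Function.not_injective_iff.1 hi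
  rw [restr, hf (fun j => (i j : ℕ)) ⟨a, b, hne, congrArg Fin.val hab⟩, smul_zero]

theorem symm_restr {f : FinArray k E} (hf : SymmetricArray f) (N : ℕ) (x : ℕ → ℝ) :
    Symm (restr f N x) := by
  intro σ i
  rw [restr, restr, hf σ fun j => (i j : ℕ), Equiv.prod_comp σ fun j => x (i j)]

theorem restr_of_not_strictMono {f : FinArray k E} (hf : Tetrahedral f) (N : ℕ) (x : ℕ → ℝ)
    (i : Fin k → Fin N) (hi : ¬ StrictMono i) : restr f N x i = 0 := by
  rw [restr, hf _ fun h => hi fun a b hab => h hab, smul_zero]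

theorem continuous_Q (f : FinArray k E) (s : ℕ → ℝ) :
    Continuous fun y : ℕ → ℝ => Q f fun _ n => s n * y n := by
  unfold Q
  fun_prop

theorem continuous_T (m : Fin k → ℕ) (f : FinArray k E) :
    Continuous fun y : ℕ → ℝ => T m f fun _ => y := by
  unfold T
  fun_prop

variable {Ω : Type*} [MeasurableSpace Ω] {μ : Measure Ω} [IsProbabilityMeasure μ] {ξ : ℕ → Ω → ℝ}

theorem measurableSet_lt_norm_Q (f : FinArray k E) (s : ℕ → ℝ) (t : ℝ) :
    MeasurableSet {y : ℕ → ℝ | t < ‖Q f fun _ n => s n * y n‖} :=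
  (isOpen_lt continuous_const (continuous_Q f s).norm).measurableSet

theorem contraction [CompleteSpace E] (hk : 0 < k) {f : FinArray k E} (hf : DiagonalFree f)
    (hξ : IsSymmIndep μ ξ) {s : ℕ → ℝ} (hs : ∀ n, |s n| ≤ 1) {t : ℝ} (ht : 0 ≤ t) :
    μ.real {ω | maxConst k * t < ‖Q f fun _ n => s n * ξ n ω‖} ≤
      maxConst k * μ.real {ω | t < ‖Q f fun _ n => ξ n ω‖} := by
  have : Nonempty (Fin k) := ⟨⟨0, hk⟩⟩
  obtain ⟨N, hN⟩ := exists_support_lt f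
  have hB := measurableSet_lt_norm_Q f (fun _ => 1) t
  simp only [one_mul] at hB
  refine hξ.measureReal_le N (measurableSet_lt_norm_Q f s (maxConst k * t)) hB fun x => ?_
  have h1 := pr_contraction (diagFree_restr hf N x) (s := fun n => s n) (fun n => hs n) ht
  have h2 := fun θ : Fin N → ℤˣ => Q_eq_form hN (fun _ => 1) x θ
  simp only [one_mul] at h2
  simpa only [Set.mem_ofPred_eq, Q_eq_form hN, h2, Fintype.card_fin] using h1

theorem maximal_inequality (hk : 0 < k) {f : FinArray k E} (hf : DiagonalFree f)
    (h : SymmetricArray f ∨ Tetrahedral f) (hξ : IsSymmIndep μ ξ) {t : ℝ} (ht : 0 ≤ t) :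
    μ.real {ω | tetConst k * t < maxT f fun _ n => ξ n ω} ≤
      tetConst k * μ.real {ω | t < ‖Q f fun _ n => ξ n ω‖} := by
  obtain ⟨N, hN⟩ := exists_support_lt f
  have hB := measurableSet_lt_norm_Q f (fun _ => 1) t
  simp only [one_mul] at hB
  have hlt : ∀ y : ℕ → ℝ, tetConst k * t < maxT f (fun _ => y) ↔
      ∃ m, tetConst k * t < ‖T m f fun _ => y‖ := fun y => lt_ciSup_iff (bddAbove_T f _)
  have hA : MeasurableSet {y : ℕ → ℝ | tetConst k * t < maxT f fun _ => y} := by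
    simp only [hlt, Set.ofPred_exists]
    exact (isOpen_iUnion fun m => isOpen_lt continuous_const (continuous_T m f).norm).measurableSet
  refine hξ.measureReal_le N hA hB fun x => ?_
  let below : ℕ → Finset (Fin N) := fun l => Finset.univ.filter fun n => (n : ℕ) ≤ l
  have h1 := pr_max_cut_le_of_symm_or_tetrahedral (L := Set.range below) (U := Subtype.val) hk
    (by
      rintro ⟨_, l, rfl⟩ ⟨_, l', rfl⟩
      rcases le_total l l' with h | h
      · exact Or.inl (Finset.monotone_filter_right _ fun n _ hn => le_trans hn h)
      · exact Or.inr (Finset.monotone_filter_right _ fun n _ hn => le_trans hn h))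
    (by
      rintro ⟨_, l, rfl⟩ a b hba ha
      have ha : (a : ℕ) ≤ l := (Finset.mem_filter.1 ha).2
      have hba : (b : ℕ) ≤ a := hba
      exact Finset.mem_filter.2 ⟨Finset.mem_univ _, hba.trans ha⟩)
    ⟨⟨_, N, rfl⟩, Finset.filter_true_of_mem fun n _ => n.2.le⟩
    (diagFree_restr hf N x)
    (h.imp (fun h => symm_restr h N x) fun h => restr_of_not_strictMono h N x) ht
  have h2 := fun θ : Fin N → ℤˣ => Q_eq_form hN (fun _ => 1) x θ
  simp only [one_mul] at h2
  simp only [Set.mem_ofPred_eq, hlt, h2]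
  refine (pr_mono ?_).trans h1
  rintro θ ⟨m, hm⟩
  rw [T_eq_form hN] at hm
  exact ⟨fun j => ⟨_, m j, rfl⟩, hm⟩

end FinArrays

end RandomPoly

theorem mainTheorem5 (k : ℕ) (hk : 0 < k) :
    (∃ c : ℝ, 0 < c ∧
      ∀ (E : Type u) [NormedAddCommGroup E] [NormedSpace ℝ E] [CompleteSpace E]
        (f : RandomPoly.FinArray k E), RandomPoly.DiagonalFree f →
      ∀ (Ω : Type v) [MeasurableSpace Ω] (μ : Measure Ω) [IsProbabilityMeasure μ]
        (ξ : ℕ → Ω → ℝ), RandomPoly.IsSymmIndep μ ξ →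
      ∀ s : ℕ → ℝ, (∀ i, |s i| ≤ 1) →
      ∀ t : ℝ, 0 < t →
        μ.real {ω | c * t < ‖RandomPoly.Q f (fun _ i => s i * ξ i ω)‖} ≤
          c * μ.real {ω | t < ‖RandomPoly.Q f (fun _ i => ξ i ω)‖}) ∧
    (∃ C : ℝ, 0 < C ∧
      ∀ (E : Type u) [NormedAddCommGroup E] [NormedSpace ℝ E] [CompleteSpace E]
        (f : RandomPoly.FinArray k E), RandomPoly.DiagonalFree f →
        (RandomPoly.SymmetricArray f ∨ RandomPoly.Tetrahedral f) →
      ∀ (Ω : Type v) [MeasurableSpace Ω] (μ : Measure Ω) [IsProbabilityMeasure μ]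
        (ξ : ℕ → Ω → ℝ), RandomPoly.IsSymmIndep μ ξ →
      ∀ t : ℝ, 0 < t →
        μ.real {ω | C * t < RandomPoly.maxT f (fun _ i => ξ i ω)} ≤
          C * μ.real {ω | t < ‖RandomPoly.Q f (fun _ i => ξ i ω)‖}) := by
  refine ⟨⟨RandomPoly.maxConst k, RandomPoly.maxConst_pos k, ?_⟩,
    ⟨RandomPoly.tetConst k,
      (RandomPoly.maxConst_pos k).trans_le (RandomPoly.maxConst_le_tetConst k), ?_⟩⟩
  · intro E _ _ _ f hf Ω _ μ _ ξ hξ s hs t ht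
    exact RandomPoly.contraction hk hf hξ hs ht.le
  · intro E _ _ _ f hf h Ω _ μ _ ξ hξ t ht
    exact RandomPoly.maximal_inequality hk hf h hξ ht.le
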